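/- **Setting.** Let $k\ge 2$. For each alternative $i\in[k]=\{1,\dots,k\}$ let $L_i$ be a positive random variable with a density such that, for some $\beta_i>0$ (its tail index), $\lim_{u\to\infty}\mathsf P(L_i>ux)/\mathsf P(L_i>u)=x^{-1/\beta_i}$ for all $x>0$. Assume that the alternative $b$ with the smallest tail index is unique: $\beta_b<\beta_i$ for all $i\ne b$. Let $X_{i,1},X_{i,2},\dots$ be the successive loss samples generated from alternative $i$; all $X_{i,j}$ are independent and $X_{i,j}$ has the law of $L_i$. Let $\delta\in(1/2,1)$ and let $\gamma_{i,t}>0$ ($i\in[k]$, $t\in\mathbb N$) be deterministic thresholds with $\lim_{t\to\infty}t^{1-\delta}\,\mathsf P(L_i>\gamma_{i,t})=1$ for every $i$. For a policy $\pi=(\pi_1,\pi_2,\dots)$ with values in $[k]$ ($\pi_s$ is the alternative sampled in stage $s$) let $N_{i,t}=\#\{s\le t:\pi_s=i\}$ and let $\alpha^\pi_t=(N_{1,t}/t,\dots,N_{k,t}/t)$ be the vector of sampling ratios. The ratio estimator of $\beta_i$ after $t$ stages is $$\hat\beta_{i,t}=\frac{\sum_{j\le N_{i,t}}(\log X_{i,j}-\log\gamma_{i,t})\mathbf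 1\{X_{i,j}>\gamma_{i,t}\}}{\sum_{j\le N_{i,t}}\mathbf 1\{X_{i,j}>\gamma_{i,t}\}} ,$$ which is defined when the denominator is not zero. The estimator is used under the requirement that $$N_{i,t}\,\mathsf P(L_i>\gamma_{i,t})\to\infty\quad\text{as }t\to\infty,\ \text{ for every } i\in[k].\tag{1}$$ With $\mathsf D(\theta\|\vartheta)=\theta/\vartheta-\log(\theta/\vartheta)-1$, the rate function on the simplex $\Delta=\{\alpha\in[0,1]^k:\sum_i\alpha_i=1\}$ is $$\mathcal G(\alpha)=\min_{i\ne b}\bigl\{\alpha_b\,\mathsf D(\theta_i(\alpha)\|\beta_b)+\alpha_i\,\mathsf D(\theta_i(\alpha)\|\beta_i)\bigr\},\qquad \theta_i(\alpha)=\frac{\alpha_b+\alpha_i}{\alpha_b/\beta_b+\alpha_i/\beta_i}$$ (the expression in braces being $0$ if $\alpha_b=\alpha_i=0$). **TIRO policy** (parameters $n_0,m\ge1$). First take $n_0$ samples from each alternative. Then, at each decision time $t=kn_0+nm$, $n=0,1,2,\dots$: (a) if all the estimates $\hat\beta_{i,t}$ are defined, let $\hat\alpha_t$ be a maximizer over $\Delta$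 of the function obtained from $\mathcal G$ by replacing $\beta_i$ by $\hat\beta_{i,t}$ for all $i$ and $b$ by an index minimizing $\hat\beta_{\cdot,t}$; if some estimate is undefined, $\hat\alpha_t$ is an arbitrary point of $\Delta$; (b) let $\bar\alpha_t$ be the minimizer over $\alpha\in\Delta$ of the Euclidean norm $\|(t+m)\hat\alpha_t-(t\alpha^\pi_t+m\alpha)\|$; (c) take $m_i$ samples from each alternative $i$, in any order, where the $m_i$ are nonnegative integers with $\sum_i m_i=m$ and $|m_i-m\bar\alpha_{i,t}|<1$ (any such rounding is allowed). **Theorem 4.** The rate function $\mathcal G$ has exactly one maximizer $\alpha^*$ over $\Delta$, and the TIRO policy is asymptotically optimal: for almost every sample path on which (1) holds, $\alpha^\pi_t\to\alpha^*$ as $t\to\infty$. In particular, if (1) holds almost surely, then $\alpha^\pi_t\to\alpha^*$ almost surely. -/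

import Mathlib

open MeasureTheory ProbabilityTheory Filter Topology

noncomputable section

namespace TIRO

/-! ### The rate function -/

/-- Kullback-Leibler divergence of the exponential law with mean `θ` from the one with mean `ϑ`. -/
def expKL (θ ϑ : ℝ) : ℝ := θ / ϑ - Real.log (θ / ϑ) - 1

/-- The rate attached to the pair `(b, i)` under the allocation `α`. If `α b = α i = 0` both
summands vanish, which is the continuous extension. -/
def pairRate {k : ℕ} (β : Fin k → ℝ) (b i : Fin k) (α : Fin k → ℝ) : ℝ :=
  α b * expKL ((α b + α i) / (α b / β b + α i / β i)) (β b)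
    + α i * expKL ((α b + α i) / (α b / β b + α i / β i)) (β i)

/-- The rate function `G` for tail indices `β` and best alternative `b`: the minimum of the pair
rates over the alternatives `i ≠ b`. -/
def rateFn {k : ℕ} (β : Fin k → ℝ) (b : Fin k) (α : Fin k → ℝ) : ℝ :=
  ⨅ i : {i : Fin k // i ≠ b}, pairRate β b i.1 α

/-- `a` maximizes `f` over the standard simplex of `ℝ^k`. -/
def IsSimplexArgmax {k : ℕ} (f : (Fin k → ℝ) → ℝ) (a : Fin k → ℝ) : Prop :=
  a ∈ stdSimplex ℝ (Fin k) ∧ IsMaxOn f (stdSimplex ℝ (Fin k)) a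

/-! ### The losses -/

/-- `μ` is the law of a positive random variable with a density whose tail is regularly varying
with tail index `β` (in the sense that `P(L > t x) / P(L > t) → x ^ (-1/β)`). -/
structure IsHeavyTailed (μ : Measure ℝ) (β : ℝ) : Prop where
  pos : ∀ᵐ x ∂μ, 0 < x
  density : μ ≪ volume
  index_pos : 0 < β
  regular : ∀ x : ℝ, 0 < x →
    Tendsto (fun t : ℝ => μ.real (Set.Ioi (t * x)) / μ.real (Set.Ioi t)) atTop
      (𝓝 (x ^ (-(1 / β))))

/-! ### Sampling policies along a sample path

Stages are numbered from `0`: `π s` is the alternative sampled in the `(s + 1)`-st stage. -/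

/-- Number of samples taken from alternative `i` in the first `t` stages. -/
def numSamples {k : ℕ} (π : ℕ → Fin k) (i : Fin k) (t : ℕ) : ℕ :=
  ((Finset.range t).filter (fun s => π s = i)).card

/-- The vector of sampling ratios after `t` stages. -/
def samplingRatio {k : ℕ} (π : ℕ → Fin k) (t : ℕ) : Fin k → ℝ :=
  fun i => (numSamples π i t : ℝ) / (t : ℝ)

/-! ### The ratio estimator of the tail index -/

/-- Number of exceedances of the threshold `c` among the first `n` samples. -/
def numExceed (x : ℕ → ℝ) (c : ℝ) (n : ℕ) : ℕ :=
  ((Finset.range n).filter (fun j => c < x j)).card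

/-- The ratio estimator computed from the first `n` samples with threshold `c`
(meaningful when there is at least one exceedance). -/
def ratioEstimator (x : ℕ → ℝ) (c : ℝ) (n : ℕ) : ℝ :=
  (∑ j ∈ (Finset.range n).filter (fun j => c < x j), (Real.log (x j) - Real.log c))
    / (numExceed x c n : ℝ)

/-! ### The policy

Along a sample path, `x i j` is the `(j + 1)`-st sample generated from alternative `i`, and
`γ i t` is the threshold used for alternative `i` after `t` stages. -/

/-- The vector of tail index estimates after `t` stages. -/
def tailEstimate {k : ℕ} (γ : Fin k → ℕ → ℝ) (x : Fin k → ℕ → ℝ) (π : ℕ → Fin k) (t : ℕ) :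
    Fin k → ℝ :=
  fun i => ratioEstimator (x i) (γ i t) (numSamples π i t)

/-- `αhat` is an estimated rate-optimal allocation after `t` stages: a point of the simplex which,
as soon as the estimates of all the tail indices are defined, maximizes the rate function with
the tail indices and the best alternative replaced by their estimates. -/
def IsPlugInAllocation {k : ℕ} (γ : Fin k → ℕ → ℝ) (x : Fin k → ℕ → ℝ) (π : ℕ → Fin k) (t : ℕ)
    (αhat : Fin k → ℝ) : Prop :=
  αhat ∈ stdSimplex ℝ (Fin k) ∧
    ((∀ i, 0 < numExceed (x i) (γ i t) (numSamples π i t)) →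
      ∃ bhat : Fin k, (∀ i, tailEstimate γ x π t bhat ≤ tailEstimate γ x π t i) ∧
        IsSimplexArgmax (rateFn (tailEstimate γ x π t) bhat) αhat)

/-- Euclidean distance between the target numbers of samples `(t + m) αhat` and the numbers of
samples obtained after allocating a batch of size `m` according to `a`. -/
def batchGap {k : ℕ} (m : ℕ) (π : ℕ → Fin k) (t : ℕ) (αhat a : Fin k → ℝ) : ℝ :=
  ‖(WithLp.toLp 2 (fun i => ((t : ℝ) + m) * αhat i - (t * samplingRatio π t i + m * a i)) :
    EuclideanSpace ℝ (Fin k))‖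

/-- `αbar` is the optimal allocation of the next batch: it minimizes `batchGap` over the simplex. -/
def IsBatchAllocation {k : ℕ} (m : ℕ) (π : ℕ → Fin k) (t : ℕ) (αhat αbar : Fin k → ℝ) : Prop :=
  αbar ∈ stdSimplex ℝ (Fin k) ∧
    IsMinOn (batchGap m π t αhat) (stdSimplex ℝ (Fin k)) αbar

/-- The sampling decisions `π` follow the TIRO policy with initial sample size `n₀` and batch size
`m` along the sample path `x`: `n₀` samples are first taken from each alternative; afterwards, at
each decision time `t = k n₀ + n m`, a batch of `m` samples is taken, in which the number of
samples from alternative `i` is a rounding (down or up) of `m * αbar i`. The rounding rule and the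
order of sampling inside the batch are free. -/
structure IsTIROPath {k : ℕ} (n₀ m : ℕ) (γ : Fin k → ℕ → ℝ) (x : Fin k → ℕ → ℝ)
    (π : ℕ → Fin k) : Prop where
  init : ∀ i, numSamples π i (k * n₀) = n₀
  step : ∀ n t : ℕ, t = k * n₀ + n * m →
    ∃ αhat αbar : Fin k → ℝ,
      IsPlugInAllocation γ x π t αhat ∧ IsBatchAllocation m π t αhat αbar ∧
        ∀ i, |((numSamples π i (t + m) : ℝ) - numSamples π i t) - m * αbar i| < 1

end TIRO

end

noncomputable section

namespace TIRO

/-! ### The pair rates -/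

/-! Put `d = 1 - δ`. Condition (1) only makes the sample counts outgrow `t ^ d`, possibly very
slowly, and at that speed second-moment bounds are not summable; consistency of the estimators at
all late times is not directly available. Two weaker facts replace it, both uniform over all
admissible sample sizes `n`, so that the dependence of the counts on the data is immaterial. (i)
Almost surely, all estimates based on at least a fixed positive fraction of `t` samples are
eventually accurate: `IsTailFamily.ae_eventually_good`, by Borel-Cantelli over geometric time
windows. (ii) With at least `K * t ^ d` samples, a window `[T, M * T]` contains an inaccurate
estimate with probability `O(1/K)`. Hence almost surely some `K` admits infinitely many accurate
windows: `IsTailFamily.long_window` and `ae_exists_frequently_notMem`.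

A single late accurate window suffices. During it the plug-in targets are close to the maximizer,
whose coordinates are positive, and the policy tracks its targets. When the window ends, every
alternative has therefore received a positive fraction of all samples. From then on (i) keeps the
estimates accurate, which keeps the targets close, which keeps the counts linear in `t`: the regime
sustains itself (`IsTIROPath.tendsto`). Within it (i) applies at every precision, so the targets
converge to the maximizer and the sampling ratios follow (`Tracks.tendsto`).

The analytic inputs are uniqueness, positivity and stability of the maximizer
(`IsSimplexArgmax.unique`, `IsSimplexArgmax.pos`, `exists_plugIn_near`). The probabilistic inputs
are the first two moments of the log-excess, obtained from a Potter-type tail bound, and the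
sandwich estimate `IsTailFamily.window`. -/

theorem expKL_self {p : ℝ} (hp : 0 < p) : expKL p p = 0 := by
  simp [expKL, div_self hp.ne']

theorem expKL_nonneg {θ p : ℝ} (hθ : 0 < θ) (hp : 0 < p) : 0 ≤ expKL θ p := by
  have := Real.log_le_sub_one_of_pos (div_pos hθ hp)
  unfold expKL; linarith

theorem expKL_pos {θ p : ℝ} (hθ : 0 < θ) (hp : 0 < p) (h : θ ≠ p) : 0 < expKL θ p := by
  have := Real.log_lt_sub_one_of_pos (div_pos hθ hp) (fun h' => h ((div_eq_one_iff_eq hp.ne').1 h'))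
  unfold expKL; linarith

/-- The weighted harmonic mean of `p` and `q` with weights `x` and `y`. -/
def mix (p q x y : ℝ) : ℝ := (x + y) / (x / p + y / q)

/-- Weighted sum of the divergences from `p` and `q`. -/
def pairKL (p q x y θ : ℝ) : ℝ := x * expKL θ p + y * expKL θ q

/-- The minimum of `pairKL p q x y` over its last argument. -/
def pairMin (p q x y : ℝ) : ℝ := pairKL p q x y (mix p q x y)

theorem pairRate_eq_pairMin {k : ℕ} (β : Fin k → ℝ) (b i : Fin k) (α : Fin k → ℝ) :
    pairRate β b i α = pairMin (β b) (β i) (α b) (α i) := rfl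

theorem pairMin_smul {p q c x y : ℝ} (hc : 0 < c) :
    pairMin p q (c * x) (c * y) = c * pairMin p q x y := by
  have : mix p q (c * x) (c * y) = mix p q x y := by
    unfold mix
    rw [← mul_add, mul_div_assoc c x, mul_div_assoc c y, ← mul_add, mul_div_mul_left _ _ hc.ne']
  unfold pairMin
  rw [this]; unfold pairKL; ring

section

variable {p q : ℝ} (hp : 0 < p) (hq : 0 < q)

include hp hq

theorem mix_denom_pos {x y : ℝ} (hx : 0 ≤ x) (hy : 0 ≤ y) (hs : 0 < x + y) :
    0 < x / p + y / q := by
  rcases hx.eq_or_lt with rfl | hx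
  · have : 0 < y := by linarith
    positivity
  · positivity

theorem mix_pos {x y : ℝ} (hx : 0 ≤ x) (hy : 0 ≤ y) (hs : 0 < x + y) : 0 < mix p q x y :=
  div_pos hs (mix_denom_pos hp hq hx hy hs)

/-- The logarithms of `p` and `q` enter `pairKL` with weights independent of `θ`, and `mix` is
chosen so that the remaining linear terms match. This Pythagorean identity exhibits `mix` as the
unique minimizer when the weights are nonnegative with positive sum; monotonicity and concavity of
`pairMin` come from it. -/
theorem pairKL_eq_pairMin_add {x y θ : ℝ} (hx : 0 ≤ x) (hy : 0 ≤ y) (hs : 0 < x + y)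
    (hθ : 0 < θ) :
    pairKL p q x y θ = pairMin p q x y + (x + y) * expKL θ (mix p q x y) := by
  have hm := mix_pos hp hq hx hy hs
  have hw := mix_denom_pos hp hq hx hy hs
  have key : mix p q x y * (x / p + y / q) = x + y := by
    unfold mix; exact div_mul_cancel₀ _ hw.ne'
  have key2 : θ * (x / p + y / q) = (x + y) * (θ / mix p q x y) := by
    rw [← key]; field_simp
  unfold pairMin pairKL expKL
  rw [Real.log_div hθ.ne' hp.ne', Real.log_div hθ.ne' hq.ne', Real.log_div hm.ne' hp.ne',
    Real.log_div hm.ne' hq.ne', Real.log_div hθ.ne' hm.ne']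
  linear_combination key2 - key

theorem pairMin_nonneg {x y : ℝ} (hx : 0 ≤ x) (hy : 0 ≤ y) : 0 ≤ pairMin p q x y := by
  rcases (add_nonneg hx hy).eq_or_lt with h | h
  · have hx0 : x = 0 := by linarith
    have hy0 : y = 0 := by linarith
    simp [pairMin, pairKL, hx0, hy0]
  · have hm := mix_pos hp hq hx hy h
    exact add_nonneg (mul_nonneg hx (expKL_nonneg hm hp)) (mul_nonneg hy (expKL_nonneg hm hq))

theorem pairMin_le_pairKL {x y θ : ℝ} (hx : 0 ≤ x) (hy : 0 ≤ y) (hθ : 0 < θ) :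
    pairMin p q x y ≤ pairKL p q x y θ := by
  rcases (add_nonneg hx hy).eq_or_lt with h | h
  · have hx0 : x = 0 := by linarith
    have hy0 : y = 0 := by linarith
    simp [pairMin, pairKL, hx0, hy0]
  · rw [pairKL_eq_pairMin_add hp hq hx hy h hθ]
    have := mul_nonneg h.le (expKL_nonneg hθ (mix_pos hp hq hx hy h))
    linarith

theorem pairMin_zero_left {y : ℝ} (hy : 0 ≤ y) : pairMin p q 0 y = 0 := by
  refine le_antisymm ?_ (pairMin_nonneg hp hq le_rfl hy)
  have := pairMin_le_pairKL hp hq le_rfl hy hq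
  simpa [pairKL, expKL_self hq] using this

theorem pairMin_zero_right {x : ℝ} (hx : 0 ≤ x) : pairMin p q x 0 = 0 := by
  refine le_antisymm ?_ (pairMin_nonneg hp hq hx le_rfl)
  have := pairMin_le_pairKL hp hq hx le_rfl hp
  simpa [pairKL, expKL_self hp] using this

theorem mix_eq_iff (hpq : p ≠ q) {x y x' y' : ℝ} (hx : 0 < x) (hy : 0 < y) (hx' : 0 < x')
    (hy' : 0 < y') : mix p q x y = mix p q x' y' ↔ x * y' = x' * y := by
  have hw := mix_denom_pos hp hq hx.le hy.le (by positivity)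
  have hw' := mix_denom_pos hp hq hx'.le hy'.le (by positivity)
  unfold mix
  rw [div_eq_div_iff hw.ne' hw'.ne']
  have : (x + y) * (x' / p + y' / q) - (x' + y') * (x / p + y / q)
      = (x * y' - x' * y) * ((p - q) / (p * q)) := by
    field_simp; ring
  constructor
  · intro h
    rw [h, sub_self] at this
    have h2 : (p - q) / (p * q) ≠ 0 := div_ne_zero (sub_ne_zero.2 hpq) (by positivity)
    have := (mul_eq_zero.1 this.symm).resolve_right h2
    linarith
  · intro h
    rw [h, sub_self, zero_mul] at this
    linarith

theorem mix_ne_left (hpq : p ≠ q) {x y : ℝ} (hx : 0 < x) (hy : 0 < y) : mix p q x y ≠ p := by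
  have hw := mix_denom_pos hp hq hx.le hy.le (by positivity)
  unfold mix
  rw [Ne, div_eq_iff hw.ne']
  intro h
  field_simp at h
  apply hpq
  have : y * (q - p) = 0 := by linarith
  have := (mul_eq_zero.1 this).resolve_left hy.ne'
  linarith

theorem pairMin_pos (hpq : p ≠ q) {x y : ℝ} (hx : 0 < x) (hy : 0 < y) :
    0 < pairMin p q x y := by
  have hm := mix_pos hp hq hx.le hy.le (by positivity)
  exact add_pos_of_pos_of_nonneg (mul_pos hx (expKL_pos hm hp (mix_ne_left hp hq hpq hx hy)))
    (mul_nonneg hy.le (expKL_nonneg hm hq))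

/-- The minimizer for the larger weights is a competitor for the smaller ones, and the extra weight
`s` pays a positive divergence because that minimizer differs from `p`. -/
theorem pairMin_lt_add_left (hpq : p ≠ q) {x y s : ℝ} (hx : 0 < x) (hy : 0 < y) (hs : 0 < s) :
    pairMin p q x y < pairMin p q (x + s) y := by
  have hxs : 0 < x + s := by positivity
  have hm := mix_pos hp hq hxs.le hy.le (by positivity)
  have h1 := pairMin_le_pairKL hp hq hx.le hy.le hm
  have h2 := mul_pos hs (expKL_pos hm hp (mix_ne_left hp hq hpq hxs hy))
  have h3 : pairMin p q (x + s) y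
      = pairKL p q x y (mix p q (x + s) y) + s * expKL (mix p q (x + s) y) p := by
    unfold pairMin pairKL; ring
  linarith

/-- A minimum of functions linear in the weights is superadditive: the minimizer for the sum is
tested in both summands. -/
theorem pairMin_add_le {x y x' y' : ℝ} (hx : 0 < x) (hy : 0 < y) (hx' : 0 < x') (hy' : 0 < y') :
    pairMin p q x y + pairMin p q x' y' ≤ pairMin p q (x + x') (y + y') := by
  have hm : 0 < mix p q (x + x') (y + y') := mix_pos hp hq (by positivity) (by positivity)
    (by positivity)
  have h1 := pairMin_le_pairKL hp hq hx.le hy.le hm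
  have h2 := pairMin_le_pairKL hp hq hx'.le hy'.le hm
  have h3 : pairMin p q (x + x') (y + y') = pairKL p q x y (mix p q (x + x') (y + y'))
      + pairKL p q x' y' (mix p q (x + x') (y + y')) := by
    unfold pairMin pairKL; ring
  linarith

theorem pairMin_add_lt (hpq : p ≠ q) {x y x' y' : ℝ} (hx : 0 < x) (hy : 0 < y) (hx' : 0 < x')
    (hy' : 0 < y') (hne : x * y' ≠ x' * y) :
    pairMin p q x y + pairMin p q x' y' < pairMin p q (x + x') (y + y') := by
  have hm : 0 < mix p q (x + x') (y + y') := mix_pos hp hq (by positivity) (by positivity)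
    (by positivity)
  have hm1 : 0 < mix p q x y := mix_pos hp hq (by positivity) (by positivity) (by positivity)
  have h1 := pairKL_eq_pairMin_add hp hq hx.le hy.le (by positivity) hm
  have h2 := pairMin_le_pairKL hp hq hx'.le hy'.le hm
  have h3 : pairMin p q (x + x') (y + y') = pairKL p q x y (mix p q (x + x') (y + y'))
      + pairKL p q x' y' (mix p q (x + x') (y + y')) := by
    unfold pairMin pairKL; ring
  have h4 : mix p q (x + x') (y + y') ≠ mix p q x y := by
    rw [Ne, mix_eq_iff hp hq hpq (by positivity) (by positivity) hx hy]
    intro h; apply hne; linarith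
  have h5 := mul_pos (add_pos hx hy) (expKL_pos hm hm1 h4)
  linarith

/-- If the pair rate is at least `v > 0` at two distinct points, it exceeds `v` halfway. -/
theorem lt_pairMin_midpoint (hpq : p ≠ q) {x y x' y' v : ℝ} (hx : 0 < x) (hy : 0 < y)
    (hx' : 0 < x') (hy' : 0 < y') (hv : 0 < v) (h : v ≤ pairMin p q x y)
    (h' : v ≤ pairMin p q x' y') (hne : x ≠ x' ∨ y ≠ y') :
    v < pairMin p q ((x + x') / 2) ((y + y') / 2) := by
  have e : pairMin p q ((x + x') / 2) ((y + y') / 2)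
      = 1 / 2 * pairMin p q (x + x') (y + y') := by
    rw [← pairMin_smul (by norm_num : (0 : ℝ) < 1 / 2)]
    congr 1 <;> ring
  rw [e]
  -- Superadditivity is strict except along rays. On a common ray the rate is linear by homogeneity,
  -- so distinct points have distinct rates, both at least `v > 0`, and their average exceeds `v`.
  by_cases hpr : x * y' = x' * y
  · have hc : 0 < x' / x := by positivity
    have ex : x' = x' / x * x := by field_simp
    have ey : y' = x' / x * y := by field_simp; linarith
    set c := x' / x
    have hc1 : c ≠ 1 := by
      intro h1; rw [h1, one_mul] at ex ey
      rcases hne with h | h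
      · exact h ex.symm
      · exact h ey.symm
    have e2 : pairMin p q (x + x') (y + y') = (1 + c) * pairMin p q x y := by
      rw [← pairMin_smul (by positivity : 0 < 1 + c)]
      congr 1
      · rw [ex]; ring
      · rw [ey]; ring
    rw [ex, ey, pairMin_smul hc] at h'
    rw [e2]
    rcases lt_or_gt_of_ne hc1 with h1 | h1
    · nlinarith
    · nlinarith
  · have := pairMin_add_lt hp hq hpq hx hy hx' hy' hpr
    linarith

theorem le_pairMin_midpoint {x y x' y' v : ℝ} (hx : 0 < x) (hy : 0 < y)
    (hx' : 0 < x') (hy' : 0 < y') (h : v ≤ pairMin p q x y)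
    (h' : v ≤ pairMin p q x' y') :
    v ≤ pairMin p q ((x + x') / 2) ((y + y') / 2) := by
  have e : pairMin p q ((x + x') / 2) ((y + y') / 2)
      = 1 / 2 * pairMin p q (x + x') (y + y') := by
    rw [← pairMin_smul (by norm_num : (0 : ℝ) < 1 / 2)]
    congr 1 <;> ring
  have := pairMin_add_le hp hq hx hy hx' hy'
  linarith

end

/-- The parameters for which the rates are well behaved. -/
def rateDomain (k : ℕ) : Set ((Fin k → ℝ) × (Fin k → ℝ)) :=
  {z | (∀ i, 0 < z.1 i) ∧ ∀ i, 0 ≤ z.2 i}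

theorem continuousOn_pairRate {k : ℕ} (b i : Fin k) :
    ContinuousOn (fun z : (Fin k → ℝ) × (Fin k → ℝ) => pairRate z.1 b i z.2) (rateDomain k) := by
  intro z hz
  have hb := hz.1 b
  have hi := hz.1 i
  have cKL : ∀ f g : (Fin k → ℝ) × (Fin k → ℝ) → ℝ, ContinuousAt f z → ContinuousAt g z →
      0 < f z → 0 < g z → ContinuousAt (fun z => expKL (f z) (g z)) z := by
    intro f g hf hg h1 h2
    have hd : ContinuousAt (fun z => f z / g z) z := hf.div hg h2.ne'
    exact (hd.sub (hd.log (div_pos h1 h2).ne')).sub continuousAt_const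
  have c1 : ∀ j, ContinuousAt (fun z : (Fin k → ℝ) × (Fin k → ℝ) => z.1 j) z :=
    fun j => by fun_prop
  have c2 : ∀ j, ContinuousAt (fun z : (Fin k → ℝ) × (Fin k → ℝ) => z.2 j) z :=
    fun j => by fun_prop
  rcases (add_nonneg (hz.2 b) (hz.2 i)).eq_or_lt with h | h
  · have hx0 : z.2 b = 0 := by linarith [hz.2 b, hz.2 i]
    have hy0 : z.2 i = 0 := by linarith [hz.2 b, hz.2 i]
    have h0 : pairRate z.1 b i z.2 = 0 := by simp [pairRate, hx0, hy0]
    unfold ContinuousWithinAt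
    simp only [h0]
    -- At zero weights `mix` has no limit. There the rate is squeezed between `0` and `pairKL`
    -- evaluated at `θ = z.1 b`, where only the second summand survives.
    have hlim : Tendsto (fun z : (Fin k → ℝ) × (Fin k → ℝ) => z.2 i * expKL (z.1 b) (z.1 i))
        (𝓝[rateDomain k] z) (𝓝 0) := by
      have : ContinuousAt (fun z : (Fin k → ℝ) × (Fin k → ℝ) =>
          z.2 i * expKL (z.1 b) (z.1 i)) z := (c2 i).mul (cKL _ _ (c1 b) (c1 i) hb hi)
      have h2 := this.tendsto
      simp only [hy0, zero_mul] at h2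
      exact h2.mono_left nhdsWithin_le_nhds
    refine tendsto_of_tendsto_of_tendsto_of_le_of_le' tendsto_const_nhds hlim ?_ ?_
    · filter_upwards [self_mem_nhdsWithin] with w hw
      exact pairMin_nonneg (hw.1 b) (hw.1 i) (hw.2 b) (hw.2 i)
    · filter_upwards [self_mem_nhdsWithin] with w hw
      have := pairMin_le_pairKL (hw.1 b) (hw.1 i) (hw.2 b) (hw.2 i) (hw.1 b)
      rw [pairRate_eq_pairMin]
      simpa [pairKL, expKL_self (hw.1 b)] using this
  · apply ContinuousAt.continuousWithinAt
    have hd := mix_denom_pos hb hi (hz.2 b) (hz.2 i) h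
    have cm : ContinuousAt (fun z : (Fin k → ℝ) × (Fin k → ℝ) =>
        (z.2 b + z.2 i) / (z.2 b / z.1 b + z.2 i / z.1 i)) z :=
      ((c2 b).add (c2 i)).div (((c2 b).div (c1 b) hb.ne').add ((c2 i).div (c1 i) hi.ne')) hd.ne'
    have hm := div_pos h hd
    exact ((c2 b).mul (cKL _ _ cm (c1 b) hm hb)).add ((c2 i).mul (cKL _ _ cm (c1 i) hm hi))

/-! ### The rate function and its maximizer -/

theorem nonempty_ne {k : ℕ} (hk : 2 ≤ k) (b : Fin k) : Nonempty {i : Fin k // i ≠ b} := by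
  have : Nontrivial (Fin k) := Fin.nontrivial_iff_two_le.2 hk
  obtain ⟨i, hi⟩ := exists_ne b
  exact ⟨⟨i, hi⟩⟩

theorem continuousOn_rateFn {k : ℕ} (hk : 2 ≤ k) (b : Fin k) :
    ContinuousOn (fun z : (Fin k → ℝ) × (Fin k → ℝ) => rateFn z.1 b z.2) (rateDomain k) := by
  have := nonempty_ne hk b
  have : (fun z : (Fin k → ℝ) × (Fin k → ℝ) => rateFn z.1 b z.2) = fun z =>
      Finset.univ.inf' Finset.univ_nonempty
        (fun i : {i : Fin k // i ≠ b} => pairRate z.1 b i.1 z.2) := by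
    funext z
    rw [Finset.inf'_univ_eq_ciInf]; rfl
  rw [this]
  exact ContinuousOn.finset_inf'_apply _ (fun i _ => continuousOn_pairRate b i.1)

theorem rateFn_le {k : ℕ} (β : Fin k → ℝ) {b i : Fin k} (hi : i ≠ b) (α : Fin k → ℝ) :
    rateFn β b α ≤ pairRate β b i α :=
  ciInf_le (Set.finite_range (fun i : {i : Fin k // i ≠ b} => pairRate β b i.1 α)).bddBelow ⟨i, hi⟩

theorem lt_rateFn {k : ℕ} (hk : 2 ≤ k) (β : Fin k → ℝ) {b : Fin k} {α : Fin k → ℝ} {v : ℝ}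
    (h : ∀ i, i ≠ b → v < pairRate β b i α) : v < rateFn β b α := by
  have := nonempty_ne hk b
  obtain ⟨i, hi⟩ := exists_eq_ciInf_of_finite
    (f := fun i : {i : Fin k // i ≠ b} => pairRate β b i.1 α)
  unfold rateFn
  rw [← hi]
  exact h i.1 i.2

theorem exists_isSimplexArgmax {k : ℕ} (hk : 2 ≤ k) {β : Fin k → ℝ} (hβ : ∀ i, 0 < β i)
    (b : Fin k) : ∃ a, IsSimplexArgmax (rateFn β b) a := by
  have : Nonempty (Fin k) := ⟨b⟩
  have hc : ContinuousOn (rateFn β b) (stdSimplex ℝ (Fin k)) :=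
    (continuousOn_rateFn hk b).comp (f := fun a => (β, a)) (by fun_prop)
      (fun a ha => ⟨hβ, ha.1⟩)
  obtain ⟨a, ha, hmax⟩ := (isCompact_stdSimplex ℝ (Fin k)).exists_isMaxOn
    ⟨_, single_mem_stdSimplex ℝ b⟩ hc
  exact ⟨a, ha, hmax⟩

/-- The uniform allocation has positive rate, whereas a vanishing coordinate makes some pair rate
vanish. -/
theorem IsSimplexArgmax.pos {k : ℕ} (hk : 2 ≤ k) {β : Fin k → ℝ} (hβ : ∀ i, 0 < β i)
    {b : Fin k} (hb : ∀ i, i ≠ b → β b < β i) {a : Fin k → ℝ}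
    (ha : IsSimplexArgmax (rateFn β b) a) : 0 < rateFn β b a ∧ ∀ i, 0 < a i := by
  have hk0 : (0 : ℝ) < k := by exact_mod_cast (by omega : 0 < k)
  have hu : (fun _ : Fin k => (1 : ℝ) / k) ∈ stdSimplex ℝ (Fin k) :=
    ⟨fun _ => by positivity, by simp [hk0.ne']⟩
  have hv : 0 < rateFn β b a := lt_of_lt_of_le
    (lt_rateFn hk β fun i hi => pairMin_pos (hβ b) (hβ i) (hb i hi).ne (by positivity)
      (by positivity)) (ha.2 hu)
  have hne : ∀ i, i ≠ b → a b ≠ 0 ∧ a i ≠ 0 := by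
    intro i hi
    have h1 := hv.trans_le (rateFn_le β hi a)
    rw [pairRate_eq_pairMin] at h1
    constructor
    · intro h0
      rw [h0, pairMin_zero_left (hβ b) (hβ i) (ha.1.1 i)] at h1
      exact lt_irrefl _ h1
    · intro h0
      rw [h0, pairMin_zero_right (hβ b) (hβ i) (ha.1.1 b)] at h1
      exact lt_irrefl _ h1
  refine ⟨hv, fun i => lt_of_le_of_ne (ha.1.1 i) (Ne.symm ?_)⟩
  by_cases hi : i = b
  · obtain ⟨j⟩ := nonempty_ne hk b
    rw [hi]; exact (hne j.1 j.2).1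
  · exact (hne i hi).2

/-- The rate function need not be strictly concave: at the midpoint of two maximizers perhaps only
one pair rate exceeds the maximum `v`. Shifting a little mass from that alternative to `b` strictly
raises every other pair rate, while continuity keeps this one above `v`, a contradiction. -/
theorem IsSimplexArgmax.unique {k : ℕ} (hk : 2 ≤ k) {β : Fin k → ℝ} (hβ : ∀ i, 0 < β i)
    {b : Fin k} (hb : ∀ i, i ≠ b → β b < β i) {a a' : Fin k → ℝ}
    (ha : IsSimplexArgmax (rateFn β b) a) (ha' : IsSimplexArgmax (rateFn β b) a') : a = a' := by
  by_contra hne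
  obtain ⟨hv, hpos⟩ := ha.pos hk hβ hb
  obtain ⟨-, hpos'⟩ := ha'.pos hk hβ hb
  set v := rateFn β b a with hvdef
  have hvv : rateFn β b a' = v := le_antisymm (ha.2 ha'.1) (ha'.2 ha.1)
  set μ : Fin k → ℝ := fun i => (a i + a' i) / 2 with hμ
  have hμpos : ∀ i, 0 < μ i := fun i => by have := hpos i; have := hpos' i; positivity
  have hle : ∀ i, i ≠ b → v ≤ pairMin (β b) (β i) (μ b) (μ i) := fun i hi =>
    le_pairMin_midpoint (hβ b) (hβ i) (hpos b) (hpos i) (hpos' b) (hpos' i)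
      (rateFn_le β hi a) (hvv ▸ rateFn_le β hi a')
  obtain ⟨j, hj, hjv⟩ : ∃ j, j ≠ b ∧ v < pairMin (β b) (β j) (μ b) (μ j) := by
    have : ∃ j, j ≠ b ∧ (a b ≠ a' b ∨ a j ≠ a' j) := by
      by_cases hab : a b = a' b
      · obtain ⟨j, hj⟩ := Function.ne_iff.1 hne
        exact ⟨j, fun h => hj (h ▸ hab), Or.inr hj⟩
      · obtain ⟨j⟩ := nonempty_ne hk b
        exact ⟨j.1, j.2, Or.inl hab⟩
    obtain ⟨j, hj, hd⟩ := this
    exact ⟨j, hj, lt_pairMin_midpoint (hβ b) (hβ j) (hb j hj).ne (hpos b) (hpos j) (hpos' b)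
      (hpos' j) hv (rateFn_le β hj a) (hvv ▸ rateFn_le β hj a') hd⟩
  -- move a little mass from `j` to `b`
  let ν : ℝ → Fin k → ℝ := fun s => Function.update (Function.update μ b (μ b + s)) j (μ j - s)
  have νb : ∀ s, ν s b = μ b + s := fun s => by
    simp [ν, Function.update_of_ne (Ne.symm hj)]
  have νj : ∀ s, ν s j = μ j - s := fun s => by simp [ν]
  have νi : ∀ s i, i ≠ b → i ≠ j → ν s i = μ i := fun s i h1 h2 => by
    simp [ν, Function.update_of_ne h1, Function.update_of_ne h2]
  have hcont : ContinuousAt (fun s => pairRate β b j (ν s)) 0 := by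
    have hν : Continuous ν := by
      refine continuous_pi fun i => ?_
      by_cases h2 : i = j
      · subst h2; simp only [νj]; fun_prop
      · by_cases h1 : i = b
        · subst h1; simp only [νb]; fun_prop
        · simp only [νi _ i h1 h2]; fun_prop
    have hnear : ∀ᶠ s in 𝓝 (0 : ℝ), (β, ν s) ∈ rateDomain k := by
      have : ∀ i, ∀ᶠ s in 𝓝 (0 : ℝ), 0 < ν s i := fun i => by
        have h0 : 0 < ν 0 i := by
          by_cases h2 : i = j
          · subst h2; rw [νj]; simpa using hμpos i
          · by_cases h1 : i = b
            · subst h1; rw [νb]; simpa using hμpos i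
            · rw [νi _ i h1 h2]; exact hμpos i
        exact ((continuous_apply i).comp hν).continuousAt.eventually (lt_mem_nhds h0)
      filter_upwards [eventually_all.2 this] with s hs
      exact ⟨hβ, fun i => (hs i).le⟩
    have h1 := (continuousOn_pairRate b j) (β, ν 0) hnear.self_of_nhds
    exact h1.tendsto.comp (tendsto_nhdsWithin_iff.2
      ⟨(continuous_const.prodMk hν).continuousAt.tendsto, hnear⟩)
  have h0 : v < pairRate β b j (ν 0) := by
    rw [pairRate_eq_pairMin, νb, νj]; simpa using hjv
  have hev : ∀ᶠ s in 𝓝[>] (0 : ℝ), v < pairRate β b j (ν s) ∧ s < μ j ∧ 0 < s :=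
    ((hcont.eventually (lt_mem_nhds h0)).filter_mono nhdsWithin_le_nhds).and
      (((gt_mem_nhds (hμpos j)).filter_mono nhdsWithin_le_nhds).and self_mem_nhdsWithin)
  obtain ⟨s, hs1, hs2, hs3⟩ := hev.exists
  have hmem : ν s ∈ stdSimplex ℝ (Fin k) := by
    constructor
    · intro i
      by_cases h2 : i = j
      · subst h2; rw [νj]; linarith
      · by_cases h1 : i = b
        · subst h1; rw [νb]; linarith [hμpos i]
        · rw [νi _ i h1 h2]; exact (hμpos i).le
    · have hs : ∑ i, μ i = 1 := by
        rw [← Finset.sum_div, Finset.sum_add_distrib, ha.1.2, ha'.1.2]; norm_num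
      rw [← hs]
      have e : ∀ i, ν s i = μ i + ((if i = b then s else 0) - (if i = j then s else 0)) := by
        intro i
        by_cases h2 : i = j
        · subst h2; rw [νj, if_neg hj, if_pos rfl]; ring
        · by_cases h1 : i = b
          · subst h1; rw [νb, if_pos rfl, if_neg h2]; ring
          · rw [νi _ i h1 h2, if_neg h1, if_neg h2]; ring
      simp only [e, Finset.sum_add_distrib, Finset.sum_sub_distrib, Finset.sum_ite_eq',
        Finset.mem_univ, if_true]
      ring
  have hlt : v < rateFn β b (ν s) := by
    refine lt_rateFn hk β fun i hi => ?_
    by_cases h2 : i = j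
    · rw [h2]; exact hs1
    · rw [pairRate_eq_pairMin, νb, νi s i hi h2]
      exact (hle i hi).trans_lt (pairMin_lt_add_left (hβ b) (hβ i) (hb i hi).ne (hμpos b)
        (hμpos i) hs3)
  exact absurd (ha.2 hmem) (not_le.2 hlt)

/-- Maximizers of the rate function depend continuously on the tail indices. -/
theorem eventually_argmax_near {k : ℕ} (hk : 2 ≤ k) {β : Fin k → ℝ} (hβ : ∀ i, 0 < β i)
    {b : Fin k} (hb : ∀ i, i ≠ b → β b < β i) {a : Fin k → ℝ}
    (ha : IsSimplexArgmax (rateFn β b) a) {ε : ℝ} (hε : 0 < ε) :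
    ∀ᶠ β' in 𝓝 β, ∀ a', IsSimplexArgmax (rateFn β' b) a' → dist a' a < ε := by
  -- Otherwise maximizers for indices tending to `β` stay away from `a`. A cluster point in the
  -- compact simplex is a maximizer for `β` by joint continuity, contradicting uniqueness.
  by_contra hcon
  obtain ⟨u, hu, hbad⟩ := exists_seq_forall_of_frequently (not_eventually.1 hcon)
  push Not at hbad
  choose c hc hcd using hbad
  obtain ⟨c', hc', φ, hφ, hlim⟩ := (isCompact_stdSimplex ℝ (Fin k)).tendsto_subseq
    (fun n => (hc n).1)
  have hpos : ∀ᶠ β' in 𝓝 β, ∀ i, 0 < β' i := eventually_all.2 fun i =>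
    (continuous_apply i).continuousAt.eventually (lt_mem_nhds (hβ i))
  have huφ := hu.comp hφ.tendsto_atTop
  have key : ∀ (d : ℕ → Fin k → ℝ) (d' : Fin k → ℝ), (∀ n, d n ∈ stdSimplex ℝ (Fin k)) →
      d' ∈ stdSimplex ℝ (Fin k) → Tendsto d atTop (𝓝 d') →
      Tendsto (fun n => rateFn (u (φ n)) b (d n)) atTop (𝓝 (rateFn β b d')) := by
    intro d d' hd hd' hdl
    refine ((continuousOn_rateFn hk b) (β, d') ⟨hβ, hd'.1⟩).tendsto.comp
      (f := fun n => (u (φ n), d n)) (tendsto_nhdsWithin_iff.2 ⟨?_, ?_⟩)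
    · exact huφ.prodMk_nhds hdl
    · filter_upwards [huφ.eventually hpos] with n hn
      exact ⟨hn, (hd n).1⟩
  have hmax : IsSimplexArgmax (rateFn β b) c' := ⟨hc', fun d hd =>
    le_of_tendsto_of_tendsto' (key (fun _ => d) d (fun _ => hd) hd tendsto_const_nhds)
      (key (fun n => c (φ n)) c' (fun n => (hc _).1) hc' hlim) (fun n => (hc (φ n)).2 hd)⟩
  have e := hmax.unique hk hβ hb ha
  have h1 := hlim.dist (tendsto_const_nhds (x := a))
  rw [e, dist_self] at h1
  exact absurd (ge_of_tendsto' h1 (fun n => hcd (φ n))) (not_le.2 hε)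

/-- If all the tail indices are estimated precisely enough, the plug-in allocation is close to the
maximizer of the rate function. -/
theorem exists_plugIn_near {k : ℕ} (hk : 2 ≤ k) {β : Fin k → ℝ} (hβ : ∀ i, 0 < β i)
    {b : Fin k} (hb : ∀ i, i ≠ b → β b < β i) {a : Fin k → ℝ}
    (ha : IsSimplexArgmax (rateFn β b) a) {ε : ℝ} (hε : 0 < ε) :
    ∃ η > 0, ∀ β' : Fin k → ℝ, (∀ i, |β' i - β i| < η) → ∀ b', (∀ i, β' b' ≤ β' i) →
      ∀ a', IsSimplexArgmax (rateFn β' b') a' → ∀ i, |a' i - a i| < ε := by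
  have h1 := eventually_argmax_near hk hβ hb ha hε
  have h2 : ∀ᶠ β' : Fin k → ℝ in 𝓝 β, ∀ i, i ≠ b → β' b < β' i := by
    refine eventually_all.2 fun i => ?_
    by_cases hi : i = b
    · simp [hi]
    · filter_upwards [(continuous_apply b).continuousAt.eventually_lt
        (continuous_apply i).continuousAt (hb i hi)] with β' h _ using h
  obtain ⟨η, hη, h⟩ := Metric.eventually_nhds_iff.1 (h1.and h2)
  refine ⟨η, hη, fun β' hd b' hb' a' ha' i => ?_⟩
  obtain ⟨h3, h4⟩ := h ((dist_pi_lt_iff hη).2 fun i => by rw [Real.dist_eq]; exact hd i)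
  -- Close enough estimates preserve the strict order, so the estimated best alternative is the true
  -- one.
  have : b' = b := by
    by_contra hne
    exact absurd (hb' b) (not_le.2 (h4 b' hne))
  subst this
  have := (dist_le_pi_dist a' a i).trans_lt (h3 a' ha')
  rwa [Real.dist_eq] at this

/-! ### Counting samples -/

theorem sum_numSamples {k : ℕ} (π : ℕ → Fin k) (t : ℕ) : ∑ i, numSamples π i t = t := by
  have := Finset.card_eq_sum_card_fiberwise (s := Finset.range t) (t := Finset.univ) (f := π)
    (fun _ _ => Finset.mem_univ _)
  rw [Finset.card_range] at this
  exact this.symm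

theorem sum_numSamples_real {k : ℕ} (π : ℕ → Fin k) (t : ℕ) :
    ∑ i, (numSamples π i t : ℝ) = t := by
  exact_mod_cast sum_numSamples π t

theorem numSamples_le {k : ℕ} (π : ℕ → Fin k) (i : Fin k) (t : ℕ) : numSamples π i t ≤ t := by
  have := Finset.card_filter_le (Finset.range t) (fun s => π s = i)
  rwa [Finset.card_range] at this

theorem numSamples_add_le {k : ℕ} (π : ℕ → Fin k) (i : Fin k) (s d : ℕ) :
    numSamples π i (s + d) ≤ numSamples π i s + d := by
  induction d with
  | zero => simp
  | succ d ih =>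
    have : numSamples π i (s + (d + 1)) ≤ numSamples π i (s + d) + 1 := by
      unfold numSamples
      rw [← add_assoc, Finset.range_add_one, Finset.filter_insert]
      split_ifs
      · exact Finset.card_insert_le _ _
      · exact Nat.le_succ _
    omega

/-- If two vectors have the same sum and one dominates the other up to `e`, they are close. -/
theorem sub_le_of_sum_eq {k : ℕ} {u v : Fin k → ℝ} {e : ℝ} (h : ∑ i, u i = ∑ i, v i)
    (hle : ∀ i, u i ≤ v i + e) (i : Fin k) : v i - k * e ≤ u i := by
  -- The deficit of `i` equals the total excess of the others, at most `(k - 1) * e`. A negative `e`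
  -- is incompatible with equal sums.
  have he : 0 ≤ e ∨ e < 0 := le_or_gt 0 e
  have h1 : ∑ j ∈ Finset.univ.erase i, u j ≤ ∑ j ∈ Finset.univ.erase i, (v j + e) :=
    Finset.sum_le_sum fun j _ => hle j
  rw [Finset.sum_add_distrib, Finset.sum_const, Finset.card_erase_of_mem (Finset.mem_univ i),
    Finset.card_univ, Fintype.card_fin, nsmul_eq_mul, Nat.cast_pred (by have := i.2; omega)] at h1
  have h2 := Finset.add_sum_erase Finset.univ u (Finset.mem_univ i)
  have h3 := Finset.add_sum_erase Finset.univ v (Finset.mem_univ i)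
  rcases he with he | he
  · linarith
  · have h4 : ∑ j, u j ≤ ∑ j, (v j + e) := Finset.sum_le_sum fun j _ => hle j
    rw [Finset.sum_add_distrib, Finset.sum_const, Finset.card_univ, Fintype.card_fin,
      nsmul_eq_mul] at h4
    have : (k : ℝ) * e < 0 := mul_neg_of_pos_of_neg (by exact_mod_cast i.pos) he
    linarith

/-! ### Tracking of the plug-in allocation -/

theorem samplingRatio_mul {k : ℕ} (π : ℕ → Fin k) (i : Fin k) (t : ℕ) :
    (t : ℝ) * samplingRatio π t i = numSamples π i t := by
  unfold samplingRatio
  rcases Nat.eq_zero_or_pos t with rfl | ht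
  · simp [numSamples]
  · have : (t : ℝ) ≠ 0 := by exact_mod_cast ht.ne'
    field_simp

/-- The optimal batch gives no sample to an alternative beyond its target. -/
theorem IsBatchAllocation.le_target {k m : ℕ} (hm : 1 ≤ m) {π : ℕ → Fin k} {t : ℕ}
    {αhat αbar : Fin k → ℝ} (hhat : αhat ∈ stdSimplex ℝ (Fin k))
    (h : IsBatchAllocation m π t αhat αbar) {j : Fin k} (hj : 0 < αbar j) :
    (numSamples π j t : ℝ) + m * αbar j ≤ ((t : ℝ) + m) * αhat j := by
  have hm0 : (0 : ℝ) < m := by exact_mod_cast hm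
  by_contra hcon
  push Not at hcon
  let e : (Fin k → ℝ) → Fin k → ℝ := fun a i =>
    ((t : ℝ) + m) * αhat i - (t * samplingRatio π t i + m * a i)
  have hsum : ∑ i, e αbar i = 0 := by
    simp only [e, samplingRatio_mul, Finset.sum_sub_distrib, Finset.sum_add_distrib,
      ← Finset.mul_sum, hhat.2, h.1.2, sum_numSamples_real]
    ring
  have hej : e αbar j < 0 := by
    simp only [e, samplingRatio_mul]; linarith
  obtain ⟨i, hi⟩ : ∃ i, 0 < e αbar i := by
    by_contra hno
    push Not at hno
    have := Finset.sum_lt_sum (s := Finset.univ) (f := e αbar) (g := fun _ => 0)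
      (fun i _ => hno i) ⟨j, Finset.mem_univ _, hej⟩
    rw [hsum] at this
    simp at this
  have hij : i ≠ j := fun h' => by rw [h'] at hi; linarith
  -- Exchange argument: the residuals sum to zero, so some `i` is below its target. Moving mass `s`
  -- from `j` to `i` changes the squared norm by `2 * m * s * (m * s - e αbar i + e αbar j)`, which
  -- is negative. The bound `s ≤ αbar j` keeps the point in the simplex.
  obtain ⟨s, hs0, hsj, hsi⟩ : ∃ s, 0 < s ∧ s ≤ αbar j ∧ m * s < e αbar i := by
    refine ⟨min (αbar j) (e αbar i / (2 * m)), by positivity, min_le_left _ _, ?_⟩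
    calc m * min (αbar j) (e αbar i / (2 * m)) ≤ m * (e αbar i / (2 * m)) := by
          gcongr; exact min_le_right _ _
      _ = e αbar i / 2 := by field_simp
      _ < e αbar i := by linarith
  let a : Fin k → ℝ := fun l => αbar l + ((if l = i then s else 0) - (if l = j then s else 0))
  have ha : a ∈ stdSimplex ℝ (Fin k) := by
    constructor
    · intro l
      have := h.1.1 l
      simp only [a]
      by_cases h1 : l = j
      · subst h1; rw [if_neg (Ne.symm hij), if_pos rfl]; linarith
      · rw [if_neg h1]; split_ifs <;> linarith
    · simp only [a, Finset.sum_add_distrib, Finset.sum_sub_distrib, Finset.sum_ite_eq',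
        Finset.mem_univ, if_true, h.1.2]
      ring
  have hmin : batchGap m π t αhat αbar ≤ batchGap m π t αhat a := h.2 ha
  have hsq : ∑ l, e αbar l ^ 2 ≤ ∑ l, e a l ^ 2 := by
    have h1 : ∀ c, batchGap m π t αhat c ^ 2 = ∑ l, e c l ^ 2 := fun c => by
      unfold batchGap
      rw [EuclideanSpace.norm_sq_eq]
      simp [e]
    rw [← h1, ← h1]
    exact pow_le_pow_left₀ (norm_nonneg _) hmin 2
  have hea : ∀ l, e a l ^ 2 = e αbar l ^ 2
      + ((if l = i then (e αbar i - m * s) ^ 2 - e αbar i ^ 2 else 0)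
        + (if l = j then (e αbar j + m * s) ^ 2 - e αbar j ^ 2 else 0)) := by
    intro l
    by_cases h1 : l = i
    · subst h1; simp only [e, a, if_true, if_neg hij]; ring
    · by_cases h2 : l = j
      · subst h2; simp only [e, a, if_true, if_neg h1]; ring
      · simp only [e, a, if_neg h1, if_neg h2]; ring
  simp only [hea, Finset.sum_add_distrib, Finset.sum_ite_eq', Finset.mem_univ, if_true] at hsq
  have hms : 0 < m * s := by positivity
  nlinarith

/-- One batch cannot push an alternative beyond its target by more than the rounding error. -/
theorem numSamples_step_le {k m : ℕ} (hm : 1 ≤ m) {π : ℕ → Fin k} {t : ℕ}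
    {αhat αbar : Fin k → ℝ} (hhat : αhat ∈ stdSimplex ℝ (Fin k))
    (h : IsBatchAllocation m π t αhat αbar) {j : Fin k}
    (hr : |((numSamples π j (t + m) : ℝ) - numSamples π j t) - m * αbar j| < 1) :
    (numSamples π j (t + m) : ℝ) ≤ max (numSamples π j t : ℝ) (((t : ℝ) + m) * αhat j + 1) := by
  rcases (h.1.1 j).eq_or_lt with h0 | h0
  · apply le_max_of_le_left
    rw [← h0, mul_zero, sub_zero] at hr
    have h1 := (abs_lt.1 hr).2
    -- With a zero batch share, an integer increment of size less than one cannot be positive.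
    have h2 : numSamples π j (t + m) < numSamples π j t + 1 := by
      have : (numSamples π j (t + m) : ℝ) < numSamples π j t + 1 := by linarith
      exact_mod_cast this
    exact_mod_cast Nat.lt_succ_iff.1 h2
  · apply le_max_of_le_right
    have h1 := (abs_lt.1 hr).2
    have := h.le_target hm hhat h0
    linarith

/-- A TIRO-like allocation at the decision times `τ + n * m` with targets `A n`. -/
def Tracks {k : ℕ} (m τ : ℕ) (π : ℕ → Fin k) (A : ℕ → Fin k → ℝ) : Prop :=
  ∀ n i, (numSamples π i (τ + (n + 1) * m) : ℝ) ≤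
    max (numSamples π i (τ + n * m) : ℝ) (((τ + (n + 1) * m : ℕ) : ℝ) * A n i + 1)

theorem IsTIROPath.exists_tracks {k n₀ m : ℕ} (hm : 1 ≤ m) {γ x : Fin k → ℕ → ℝ}
    {π : ℕ → Fin k} (h : IsTIROPath n₀ m γ x π) :
    ∃ A : ℕ → Fin k → ℝ, (∀ n, IsPlugInAllocation γ x π (k * n₀ + n * m) (A n)) ∧
      Tracks m (k * n₀) π A := by
  choose A B hA hB hr using fun n => h.step n _ rfl
  refine ⟨A, hA, fun n i => ?_⟩
  have e : k * n₀ + (n + 1) * m = k * n₀ + n * m + m := by ring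
  have := numSamples_step_le hm (hA n).1 (hB n) (hr n i)
  rw [e, Nat.cast_add (k * n₀ + n * m) m]
  exact this

/-- A count can rise only up to its current target plus one; the initial count is bounded by the
elapsed time. -/
theorem Tracks.le_max {k m τ : ℕ} {π : ℕ → Fin k} {A : ℕ → Fin k → ℝ} (h : Tracks m τ π A)
    {n₁ : ℕ} {i : Fin k} {a : ℝ} (ha : 0 ≤ a) {n : ℕ} (hn : n₁ ≤ n)
    (hA : ∀ l, n₁ ≤ l → l < n → A l i ≤ a) :
    (numSamples π i (τ + n * m) : ℝ) ≤
      max ((τ + n₁ * m : ℕ) : ℝ) (((τ + n * m : ℕ) : ℝ) * a + 1) := by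
  induction n, hn using Nat.le_induction with
  | base => exact le_max_of_le_left (by exact_mod_cast numSamples_le π i _)
  | succ n hn ih =>
    have h1 := ih fun l h1 h2 => hA l h1 (h2.trans (Nat.lt_succ_self n))
    refine (h n i).trans (max_le (h1.trans (max_le_max le_rfl ?_)) (le_max_of_le_right ?_))
    · gcongr
      omega
    · gcongr
      exact hA n hn (Nat.lt_succ_self n)

/-- Once the targets have been close to `a` for long enough, so are the numbers of samples. -/
theorem Tracks.numSamples_le {k m τ : ℕ} {π : ℕ → Fin k} {A : ℕ → Fin k → ℝ}
    (h : Tracks m τ π A) {a : Fin k → ℝ} {c e : ℝ} (hc : 0 < c) (hca : ∀ i, c ≤ a i) (he : 0 ≤ e)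
    {n₁ n : ℕ} (hn : n₁ ≤ n) (hA : ∀ l, n₁ ≤ l → l < n → ∀ i, A l i ≤ a i + e)
    (hlong : ((τ + n₁ * m : ℕ) : ℝ) ≤ c * ((τ + n * m : ℕ) : ℝ)) (i : Fin k) :
    (numSamples π i (τ + n * m) : ℝ) ≤ ((τ + n * m : ℕ) : ℝ) * (a i + e) + 1 := by
  have h0 : 0 ≤ a i + e := by linarith [hca i]
  refine (h.le_max h0 hn fun l h1 h2 => hA l h1 h2 i).trans (max_le ?_ le_rfl)
  have : c * ((τ + n * m : ℕ) : ℝ) ≤ (a i + e) * ((τ + n * m : ℕ) : ℝ) := by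
    gcongr; linarith [hca i]
  linarith

/-- Tracking controls counts only from above. The lower bound follows because the counts add up to
the time and no other alternative can absorb the shortfall. -/
theorem Tracks.le_numSamples {k m τ : ℕ} {π : ℕ → Fin k} {A : ℕ → Fin k → ℝ}
    (h : Tracks m τ π A) {a : Fin k → ℝ} (hsum : ∑ i, a i = 1) {c e : ℝ} (hc : 0 < c)
    (hca : ∀ i, c ≤ a i) (he : 0 ≤ e)
    {n₁ n : ℕ} (hn : n₁ ≤ n) (hA : ∀ l, n₁ ≤ l → l < n → ∀ i, A l i ≤ a i + e)
    (hlong : ((τ + n₁ * m : ℕ) : ℝ) ≤ c * ((τ + n * m : ℕ) : ℝ)) (i : Fin k) :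
    ((τ + n * m : ℕ) : ℝ) * (a i - k * e) - k ≤ (numSamples π i (τ + n * m) : ℝ) := by
  set t : ℝ := ((τ + n * m : ℕ) : ℝ) with ht
  have := sub_le_of_sum_eq (u := fun i => (numSamples π i (τ + n * m) : ℝ))
    (v := fun i => t * a i) (e := t * e + 1)
    (by rw [sum_numSamples_real, ← Finset.mul_sum, hsum, mul_one])
    (fun i => by
      have := h.numSamples_le hc hca he hn hA hlong i
      rw [← ht] at this
      linarith) i
  linarith

/-- If the targets converge to a point with positive coordinates, so do the sampling ratios. -/
theorem Tracks.tendsto {k m τ : ℕ} (hm : 1 ≤ m) {π : ℕ → Fin k} {A : ℕ → Fin k → ℝ}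
    (h : Tracks m τ π A) {a : Fin k → ℝ} (ha : a ∈ stdSimplex ℝ (Fin k)) {c : ℝ} (hc : 0 < c)
    (hca : ∀ i, c ≤ a i) (hA : ∀ e > 0, ∀ᶠ n in atTop, ∀ i, A n i ≤ a i + e) :
    Tendsto (fun t => samplingRatio π t) atTop (𝓝 a) := by
  have hm0 : (0 : ℝ) < m := by exact_mod_cast hm
  have hup : ∀ e > 0, ∀ᶠ t : ℕ in atTop, ∀ i, samplingRatio π t i ≤ a i + e := by
    intro e he
    obtain ⟨n₁, hn₁⟩ := eventually_atTop.1 (hA (e / 2) (half_pos he))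
    -- The summands ensure, in turn: the initial count is absorbed (`q3`), the rounding error and
    -- the incomplete batch cost at most `t * e / 2` (`h5`), and the last decision time before `t`
    -- comes after the index `n₁`.
    obtain ⟨T, hT⟩ := exists_nat_ge (((τ + n₁ * m : ℕ) : ℝ) / c + (1 + m) / (e / 2) + τ + m
      + n₁ * m)
    filter_upwards [eventually_ge_atTop T] with t ht i
    have ht' : (T : ℝ) ≤ t := by exact_mod_cast ht
    have p1 : 0 ≤ ((τ + n₁ * m : ℕ) : ℝ) / c := by positivity
    have p2 : 0 ≤ (1 + m) / (e / 2) := by positivity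
    have p3 : (0 : ℝ) ≤ n₁ * m := by positivity
    have p4 : (0 : ℝ) ≤ τ := by positivity
    have q1 : τ ≤ t := by
      have : (τ : ℝ) ≤ t := by linarith
      exact_mod_cast this
    set n := (t - τ) / m with hn
    have d1 : n * m ≤ t - τ := Nat.div_mul_le_self _ _
    have d2 : t - τ < n * m + m := by
      have := Nat.lt_div_mul_add (a := t - τ) (b := m) hm
      omega
    have e1 : τ + n * m ≤ t := by omega
    have e2 : t < τ + n * m + m := by omega
    have e2' : (t : ℝ) < ((τ + n * m : ℕ) : ℝ) + m := by exact_mod_cast e2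
    have e1' : ((τ + n * m : ℕ) : ℝ) ≤ t := by exact_mod_cast e1
    have q2 : n₁ ≤ n := by
      have : (n₁ : ℝ) * m ≤ n * m := by
        push_cast at e2'
        linarith
      exact_mod_cast le_of_mul_le_mul_right this hm0
    have q3 : ((τ + n₁ * m : ℕ) : ℝ) ≤ c * ((τ + n * m : ℕ) : ℝ) := by
      rw [← div_le_iff₀' hc]
      linarith
    have key := h.numSamples_le hc hca (half_pos he).le q2
      (fun l h1 _ i => hn₁ l h1 i) q3 i
    have h2 : (numSamples π i t : ℝ) ≤ numSamples π i (τ + n * m) + m := by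
      have h3 := numSamples_add_le π i (τ + n * m) (t - (τ + n * m))
      rw [Nat.add_sub_cancel' e1] at h3
      have : numSamples π i t ≤ numSamples π i (τ + n * m) + m := by omega
      exact_mod_cast this
    have ht0 : (0 : ℝ) < t := by linarith
    have h5 : (1 + m : ℝ) ≤ t * (e / 2) := by
      rw [← div_le_iff₀ (half_pos he)]
      linarith
    have h6 : ((τ + n * m : ℕ) : ℝ) * (a i + e / 2) ≤ t * (a i + e / 2) := by
      have := ha.1 i
      gcongr
    unfold samplingRatio
    rw [div_le_iff₀ ht0]
    linarith
  rw [tendsto_pi_nhds]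
  intro i
  have hk0 : (0 : ℝ) < k := by exact_mod_cast i.pos
  rw [Metric.tendsto_atTop]
  intro e he
  obtain ⟨T, hT⟩ := eventually_atTop.1 (hup (e / (2 * k)) (by positivity))
  refine ⟨T + 1, fun t ht => ?_⟩
  have ht0 : (t : ℝ) ≠ 0 := by
    have : t ≠ 0 := by omega
    exact_mod_cast this
  have h1 := hT t (by omega)
  have h2 := sub_le_of_sum_eq (u := samplingRatio π t) (v := a) (by
    unfold samplingRatio
    rw [← Finset.sum_div, sum_numSamples_real, div_self ht0, ha.2]) h1 i
  have h3 : (k : ℝ) * (e / (2 * k)) = e / 2 := by field_simp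
  have h4 : e / (2 * k) ≤ e / 2 := by
    have : (1 : ℝ) ≤ k := by exact_mod_cast i.pos
    gcongr
    linarith
  have h5 := h1 i
  rw [Real.dist_eq, abs_lt]
  constructor <;> linarith

/-! ### Moments of the logarithmic excess over a high threshold -/

/-- The logarithmic excess of `x` over the threshold `c`. -/
def logExcess (c x : ℝ) : ℝ := if c < x then Real.log x - Real.log c else 0

theorem logExcess_nonneg {c : ℝ} (hc : 0 < c) (x : ℝ) : 0 ≤ logExcess c x := by
  unfold logExcess
  split_ifs with h
  · exact sub_nonneg.2 (Real.log_le_log hc h.le)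
  · exact le_rfl

theorem logExcess_anti {c d : ℝ} (hc : 0 < c) (h : c ≤ d) (x : ℝ) :
    logExcess d x ≤ logExcess c x := by
  by_cases hd : d < x
  · have := Real.log_le_log hc h
    unfold logExcess
    rw [if_pos hd, if_pos (h.trans_lt hd)]
    linarith
  · have := logExcess_nonneg hc x
    unfold logExcess at *
    rwa [if_neg hd]

theorem measurable_logExcess (c : ℝ) : Measurable (logExcess c) :=
  Measurable.ite measurableSet_Ioi (Real.measurable_log.sub_const _) measurable_const

theorem setOf_lt_logExcess {c u : ℝ} (hc : 0 < c) (hu : 0 < u) :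
    {x | u < logExcess c x} = Set.Ioi (c * Real.exp u) := by
  have h1 : c < c * Real.exp u := lt_mul_of_one_lt_right hc (Real.one_lt_exp_iff.2 hu)
  ext x
  simp only [Set.mem_ofPred_eq, Set.mem_Ioi, logExcess]
  by_cases hx : c < x
  · have hx0 := hc.trans hx
    rw [if_pos hx, lt_sub_iff_add_lt, Real.lt_log_iff_exp_lt hx0, Real.exp_add, Real.exp_log hc,
      mul_comm]
  · rw [if_neg hx]
    constructor <;> intro h <;> linarith

namespace IsHeavyTailed

variable {μ : Measure ℝ} [IsProbabilityMeasure μ] {β : ℝ}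

/-- At `x = 1` the regular-variation quotient tends to one, whereas a vanishing tail would make it
`0 / 0 = 0`. -/
theorem tail_pos (h : IsHeavyTailed μ β) (c : ℝ) : 0 < μ.real (Set.Ioi c) := by
  have h1 := h.regular 1 one_pos
  simp only [mul_one, Real.one_rpow] at h1
  obtain ⟨t, ht, htc⟩ := ((h1.eventually (lt_mem_nhds (zero_lt_one))).and
    (eventually_ge_atTop c)).exists
  have h2 : 0 < μ.real (Set.Ioi t) := lt_of_le_of_ne measureReal_nonneg fun h0 => by
    rw [← h0, div_zero] at ht
    exact lt_irrefl _ ht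
  exact h2.trans_le (measureReal_mono (Set.Ioi_subset_Ioi htc))

/-- A Potter-type bound for the tail. -/
theorem exists_tail_le (h : IsHeavyTailed μ β) :
    ∃ a > 0, ∀ᶠ c : ℝ in atTop, ∀ u : ℝ, 0 ≤ u →
      μ.real (Set.Ioi (c * Real.exp u)) ≤ Real.exp (a * (1 - u)) * μ.real (Set.Ioi c) := by
  have hβ := h.index_pos
  -- Half the limiting decay exponent: one multiplication of the threshold by `exp 1` then
  -- eventually costs a factor `exp (-a)`. Iterating `⌊u⌋₊` times gives the bound, and the floor
  -- loses at most `exp a`.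
  set a : ℝ := 1 / (2 * β) with ha
  have ha0 : 0 < a := by positivity
  refine ⟨a, ha0, ?_⟩
  have h1 := h.regular (Real.exp 1) (Real.exp_pos 1)
  have h2 : Real.exp 1 ^ (-(1 / β)) < Real.exp (-a) := by
    rw [← Real.exp_mul, one_mul, Real.exp_lt_exp, neg_lt_neg_iff, ha]
    exact one_div_lt_one_div_of_lt hβ (by linarith)
  obtain ⟨c₀, hc₀⟩ := eventually_atTop.1 (h1.eventually (gt_mem_nhds h2))
  have h3 : ∀ c, c₀ ≤ c →
      μ.real (Set.Ioi (c * Real.exp 1)) ≤ Real.exp (-a) * μ.real (Set.Ioi c) := fun c hc =>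
    ((div_lt_iff₀ (h.tail_pos c)).1 (hc₀ c hc)).le
  filter_upwards [eventually_ge_atTop c₀, eventually_gt_atTop 0] with c hc hcpos u hu
  have h4 : ∀ n : ℕ, μ.real (Set.Ioi (c * Real.exp n)) ≤ Real.exp (-a * n) * μ.real (Set.Ioi c) := by
    intro n
    induction n with
    | zero => simp
    | succ n ih =>
      have hle : c₀ ≤ c * Real.exp n :=
        hc.trans (le_mul_of_one_le_right hcpos.le (Real.one_le_exp (Nat.cast_nonneg n)))
      have h5 := h3 _ hle
      rw [mul_assoc, ← Real.exp_add] at h5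
      push_cast
      calc _ ≤ _ := h5
        _ ≤ Real.exp (-a) * (Real.exp (-a * n) * μ.real (Set.Ioi c)) := by gcongr
        _ = _ := by rw [← mul_assoc, ← Real.exp_add]; ring_nf
  calc μ.real (Set.Ioi (c * Real.exp u))
      ≤ μ.real (Set.Ioi (c * Real.exp (⌊u⌋₊ : ℝ))) := by
        refine measureReal_mono (Set.Ioi_subset_Ioi ?_)
        gcongr
        exact Nat.floor_le hu
    _ ≤ Real.exp (-a * ⌊u⌋₊) * μ.real (Set.Ioi c) := h4 _
    _ ≤ Real.exp (a * (1 - u)) * μ.real (Set.Ioi c) := by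
        refine mul_le_mul_of_nonneg_right (Real.exp_le_exp.2 ?_) measureReal_nonneg
        have := Nat.lt_floor_add_one u
        nlinarith

/-- Layer-cake formula with weight `2 * u`. Half of the exponential decay of the tail absorbs the
factor `u`. -/
theorem exists_sq_le (h : IsHeavyTailed μ β) :
    ∃ C, ∀ᶠ c : ℝ in atTop, MemLp (logExcess c) 2 μ ∧
      ∫ x, logExcess c x ^ 2 ∂μ ≤ C * μ.real (Set.Ioi c) := by
  obtain ⟨a, ha, hev⟩ := h.exists_tail_le
  set g : ℝ → ℝ := fun u => 2 / a * Real.exp a * Real.exp (-(a / 2) * u) with hg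
  have hgi : IntegrableOn g (Set.Ioi 0) :=
    (integrableOn_exp_mul_Ioi (by linarith : -(a / 2) < 0) 0).const_mul _
  refine ⟨2 * ∫ u in Set.Ioi 0, g u, ?_⟩
  filter_upwards [hev, eventually_gt_atTop 0] with c hc hcpos
  have hp := h.tail_pos c
  have hm := measurable_logExcess c
  have hnn := logExcess_nonneg hcpos
  have hg0 : ∀ u, 0 ≤ g u := fun u => by positivity
  have key : ∫⁻ x, ENNReal.ofReal (logExcess c x ^ 2) ∂μ
      ≤ ENNReal.ofReal (2 * (∫ u in Set.Ioi 0, g u) * μ.real (Set.Ioi c)) := by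
    have h1 := lintegral_rpow_eq_lintegral_meas_lt_mul μ (ae_of_all _ hnn) hm.aemeasurable
      (zero_lt_two' ℝ)
    simp only [Real.rpow_two] at h1
    rw [h1, mul_assoc, ENNReal.ofReal_mul zero_le_two]
    gcongr
    rw [mul_comm, ← integral_const_mul, ofReal_integral_eq_lintegral_ofReal
      (hgi.const_mul _) (ae_of_all _ fun u => mul_nonneg hp.le (hg0 u))]
    refine lintegral_mono_ae ?_
    filter_upwards [ae_restrict_mem measurableSet_Ioi] with u hu
    have hu : 0 < u := hu
    rw [setOf_lt_logExcess hcpos hu, ← ofReal_measureReal,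
      ← ENNReal.ofReal_mul measureReal_nonneg]
    apply ENNReal.ofReal_le_ofReal
    have h2 : u ^ ((2 : ℝ) - 1) = u := by norm_num
    rw [h2]
    have h3 : u ≤ 2 / a * Real.exp (a / 2 * u) := by
      have := Real.add_one_le_exp (a / 2 * u)
      rw [div_mul_eq_mul_div, le_div_iff₀ ha]
      linarith
    calc μ.real (Set.Ioi (c * Real.exp u)) * u
        ≤ (Real.exp (a * (1 - u)) * μ.real (Set.Ioi c)) * (2 / a * Real.exp (a / 2 * u)) := by
          gcongr
          exact hc u hu.le
      _ = μ.real (Set.Ioi c) * (2 / a * (Real.exp (a * (1 - u)) * Real.exp (a / 2 * u))) := by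
          ring
      _ = μ.real (Set.Ioi c) * g u := by
          simp only [hg]
          rw [mul_assoc (2 / a), ← Real.exp_add, ← Real.exp_add]
          ring_nf
  have hint : Integrable (fun x => logExcess c x ^ 2) μ := by
    refine ⟨(hm.pow_const 2).aestronglyMeasurable, ?_⟩
    rw [hasFiniteIntegral_iff_ofReal (ae_of_all _ fun x => sq_nonneg _)]
    exact key.trans_lt ENNReal.ofReal_lt_top
  refine ⟨(memLp_two_iff_integrable_sq hm.aestronglyMeasurable).2 hint, ?_⟩
  rw [integral_eq_lintegral_of_nonneg_ae (ae_of_all _ fun x => sq_nonneg _)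
    (hm.pow_const 2).aestronglyMeasurable]
  refine ENNReal.toReal_le_of_le_ofReal ?_ key
  have : 0 ≤ ∫ u in Set.Ioi 0, g u := integral_nonneg hg0
  positivity

/-- The mean excess of the logarithm converges to the tail index. -/
theorem tendsto_mean_logExcess (h : IsHeavyTailed μ β) :
    Tendsto (fun c => (∫ x, logExcess c x ∂μ) / μ.real (Set.Ioi c)) atTop (𝓝 β) := by
  have hβ := h.index_pos
  obtain ⟨a, ha, hev⟩ := h.exists_tail_le
  obtain ⟨C, hC⟩ := h.exists_sq_le
  -- By the layer-cake formula the mean excess is the integral of the tail quotient at `exp u`. The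
  -- Potter-type bound dominates it, and the limit is the integral of `exp (-u / β)`, namely `β`.
  have h1 : Tendsto (fun c => ∫ u in Set.Ioi (0 : ℝ),
      μ.real (Set.Ioi (c * Real.exp u)) / μ.real (Set.Ioi c)) atTop
      (𝓝 (∫ u in Set.Ioi (0 : ℝ), Real.exp u ^ (-(1 / β)))) := by
    refine tendsto_integral_filter_of_dominated_convergence
      (fun u => Real.exp a * Real.exp (-a * u)) ?_ ?_ ?_ ?_
    · filter_upwards [eventually_gt_atTop 0] with c hc
      have : Antitone fun u => μ.real (Set.Ioi (c * Real.exp u)) := fun u v huv =>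
        measureReal_mono (Set.Ioi_subset_Ioi (by gcongr))
      exact (this.measurable.div_const _).aestronglyMeasurable
    · filter_upwards [hev] with c hc
      filter_upwards [ae_restrict_mem measurableSet_Ioi] with u hu
      have hu : 0 < u := hu
      rw [Real.norm_of_nonneg (by positivity), div_le_iff₀ (h.tail_pos c), ← Real.exp_add]
      have := hc u hu.le
      ring_nf at this ⊢
      exact this
    · exact (integrableOn_exp_mul_Ioi (by linarith : -a < 0) 0).const_mul _
    · exact ae_of_all _ fun u => h.regular _ (Real.exp_pos u)
  have h2 : ∫ u in Set.Ioi (0 : ℝ), Real.exp u ^ (-(1 / β)) = β := by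
    have e : ∀ u : ℝ, Real.exp u ^ (-(1 / β)) = Real.exp (-(1 / β) * u) := fun u => by
      rw [← Real.exp_mul, mul_comm]
    simp only [e]
    rw [integral_exp_mul_Ioi (by rw [neg_lt_zero]; positivity) 0]
    simp
  rw [h2] at h1
  refine h1.congr' ?_
  filter_upwards [hC, eventually_gt_atTop 0] with c hc hcpos
  have hi : Integrable (logExcess c) μ := hc.1.integrable (by norm_num)
  rw [hi.integral_eq_integral_meas_lt (ae_of_all _ (logExcess_nonneg hcpos)), integral_div]
  congr 1
  refine setIntegral_congr_fun measurableSet_Ioi fun u hu => ?_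
  rw [setOf_lt_logExcess hcpos hu]

end IsHeavyTailed

/-! ### A uniform law of large numbers for tail statistics -/

/-- A family of nonnegative statistics, decreasing in a threshold `c t`, whose first and second
moments under `μ` are of order `t ^ (-d)`. -/
structure IsTailFamily (μ : Measure ℝ) (d : ℝ) (h : ℕ → ℝ → ℝ) : Prop where
  nonneg : ∀ t x, 0 ≤ h t x
  meas : ∀ t, Measurable (h t)
  anti : ∃ c : ℕ → ℝ, ∀ s t, c s ≤ c t → ∀ x, h t x ≤ h s x
  mean : Tendsto (fun t : ℕ => (t : ℝ) ^ d * ∫ x, h t x ∂μ) atTop (𝓝 1)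
  sq : ∃ C, ∀ᶠ t : ℕ in atTop, MemLp (h t) 2 μ ∧ (t : ℝ) ^ d * ∫ x, h t x ^ 2 ∂μ ≤ C

/-- The normalized sum of the statistics of the first `n` samples is within a factor `1 ± ε` of
its mean. -/
def GoodSum (h : ℕ → ℝ → ℝ) (d ε : ℝ) (z : ℕ → ℝ) (n t : ℕ) : Prop :=
  |(t : ℝ) ^ d * ∑ j ∈ Finset.range n, h t (z j) - n| ≤ ε * n

section

variable {Ω : Type*} [MeasurableSpace Ω] {P : Measure Ω} [IsProbabilityMeasure P]
  {μ : Measure ℝ} {Z : ℕ → Ω → ℝ} (hZm : ∀ j, Measurable (Z j))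
  (hZl : ∀ j, P.map (Z j) = μ) (hZi : Pairwise fun i j => IndepFun (Z i) (Z j) P)

include hZm hZl hZi

theorem measure_deviation_le {f : ℝ → ℝ} (hf : Measurable f) (hL : MemLp f 2 μ) (n : ℕ) {a : ℝ}
    (ha : 0 < a) :
    P {ω | a ≤ |∑ j ∈ Finset.range n, f (Z j ω) - n * ∫ x, f x ∂μ|}
      ≤ ENNReal.ofReal (n * (∫ x, f x ^ 2 ∂μ) / a ^ 2) := by
  have hY : ∀ j, MemLp (fun ω => f (Z j ω)) 2 P := fun j => by
    rw [← hZl j] at hL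
    exact hL.comp_of_map (hZm j).aemeasurable
  have hE : ∀ j, ∫ ω, f (Z j ω) ∂P = ∫ x, f x ∂μ := fun j => by
    rw [← hZl j, integral_map (hZm j).aemeasurable hf.aestronglyMeasurable]
  have hE2 : ∀ j, ∫ ω, f (Z j ω) ^ 2 ∂P = ∫ x, f x ^ 2 ∂μ := fun j => by
    rw [← hZl j, integral_map (hZm j).aemeasurable (hf.pow_const 2).aestronglyMeasurable]
  have hS : MemLp (∑ j ∈ Finset.range n, fun ω => f (Z j ω)) 2 P :=
    memLp_finsetSum' _ fun j _ => hY j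
  have hES : ∫ ω, (∑ j ∈ Finset.range n, fun ω => f (Z j ω)) ω ∂P = n * ∫ x, f x ∂μ := by
    simp only [Finset.sum_apply]
    rw [integral_finsetSum _ fun j _ => (hY j).integrable (by norm_num)]
    simp [hE]
  have hV : variance (∑ j ∈ Finset.range n, fun ω => f (Z j ω)) P ≤ n * ∫ x, f x ^ 2 ∂μ := by
    rw [IndepFun.variance_sum (fun j _ => hY j)
      (fun i _ j _ hij => (hZi hij).comp hf hf)]
    calc ∑ j ∈ Finset.range n, variance (fun ω => f (Z j ω)) P
        ≤ ∑ j ∈ Finset.range n, ∫ x, f x ^ 2 ∂μ := by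
          refine Finset.sum_le_sum fun j _ => ?_
          rw [← hE2 j]
          exact variance_le_expectation_sq (hY j).aestronglyMeasurable
      _ = _ := by simp
  have := meas_ge_le_variance_div_sq hS ha
  rw [hES] at this
  simp only [Finset.sum_apply] at this
  refine this.trans (ENNReal.ofReal_le_ofReal ?_)
  gcongr

/-- The sums increase in `n` and decrease in the threshold, so all pairs `(n, t)` are sandwiched
between a geometric grid of sample sizes and the two extreme thresholds of the window. On the grid,
Chebyshev's bounds decay geometrically and sum to `O(1/K)`. -/
theorem IsTailFamily.window {d : ℝ} (hd0 : 0 < d) (hd1 : d < 1) {h : ℕ → ℝ → ℝ}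
    (hh : IsTailFamily μ d h) {ε : ℝ} (hε : 0 < ε) :
    ∃ l > 1, ∃ C ≥ 0, ∃ T₀ ≥ 1, ∀ T : ℝ, T₀ ≤ T → ∀ K : ℝ, 1 ≤ K →
      P {ω | ∃ t : ℕ, T ≤ t ∧ t ≤ l * T ∧ ∃ n : ℕ, K * T ^ d ≤ n ∧
        ¬ GoodSum h d ε (fun j => Z j ω) n t} ≤ ENNReal.ofReal (C / K) := by
  -- The powers count sandwich losses. Upward: one factor `l` each from the time power, the
  -- deviation and the mean, and two from the grid. Downward: two each from the grid and the mean,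
  -- with `2 - l = 1 - (l - 1)` from the deviation.
  obtain ⟨l, hl1, hl2, hl3, hl4⟩ : ∃ l : ℝ, 1 < l ∧ l < 2 ∧ l ^ 5 < 1 + ε ∧
      (1 - ε) * l ^ 4 < 2 - l := by
    have e1 : ∀ᶠ l : ℝ in 𝓝[>] 1, l < 2 :=
      (gt_mem_nhds one_lt_two).filter_mono nhdsWithin_le_nhds
    have c2 : ContinuousAt (fun l : ℝ => l ^ 5) 1 := by fun_prop
    have c3 : ContinuousAt (fun l : ℝ => (1 - ε) * l ^ 4) 1 := by fun_prop
    have c4 : ContinuousAt (fun l : ℝ => 2 - l) 1 := by fun_prop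
    have e2 := (c2.eventually (gt_mem_nhds (by norm_num; exact hε : (1 : ℝ) ^ 5 < 1 + ε))).filter_mono
      (nhdsWithin_le_nhds (s := Set.Ioi 1))
    have e3 := (c3.eventually_lt c4 (by norm_num; exact hε)).filter_mono
      (nhdsWithin_le_nhds (s := Set.Ioi 1))
    have e4 : ∀ᶠ l : ℝ in 𝓝[>] 1, 1 < l := self_mem_nhdsWithin
    obtain ⟨l, h1, h2, h3, h4⟩ := (e4.and (e1.and (e2.and e3))).exists
    exact ⟨l, h1, h2, h3, h4⟩
  have hl0 : 0 < l := by linarith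
  have hlm : 0 < l - 1 := by linarith
  obtain ⟨C₀, hC₀⟩ := hh.sq
  obtain ⟨c, hc⟩ := hh.anti
  have hmean := (hh.mean.eventually (lt_mem_nhds (inv_lt_one_of_one_lt₀ hl1))).and
    (hh.mean.eventually (gt_mem_nhds hl1))
  obtain ⟨T₁, hT₁⟩ := eventually_atTop.1 (hmean.and hC₀)
  -- Makes the rounding in the grid `N` negligible: the ceiling adds at most `l * (l - 1) * N s`, so
  -- consecutive grid points have ratio at most `l ^ 2`.
  obtain ⟨T₂, hT₂⟩ := eventually_atTop.1 ((tendsto_rpow_atTop hd0).eventually_ge_atTop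
    (1 / (l * (l - 1))))
  set C₁ : ℝ := |C₀| * l ^ 4 / (l - 1) ^ 2 with hC₁
  have hC₁0 : 0 ≤ C₁ := by positivity
  have hr0 : (0 : ℝ) ≤ l⁻¹ := by positivity
  have hr1 : l⁻¹ < 1 := inv_lt_one_of_one_lt₀ hl1
  refine ⟨l, hl1, 2 * C₁ * (1 - l⁻¹)⁻¹, mul_nonneg (by positivity)
    (inv_nonneg.2 (by linarith)), max 1 (max T₁ T₂), le_max_left _ _, fun T hT K hK => ?_⟩
  have hT1 : 1 ≤ T := (le_max_left _ _).trans hT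
  have hTT₁ : (T₁ : ℝ) ≤ T := ((le_max_left _ _).trans (le_max_right _ _)).trans hT
  have hQl : 1 / (l * (l - 1)) ≤ T ^ d :=
    hT₂ T (((le_max_right _ _).trans (le_max_right _ _)).trans hT)
  have hT0 : 0 < T := by linarith
  have hK0 : 0 < K := by linarith
  set Q : ℝ := T ^ d with hQ
  have hQ0 : 0 < Q := Real.rpow_pos_of_pos hT0 d
  have hQt : ∀ t : ℕ, T ≤ t → t ≤ l * T → Q ≤ (t : ℝ) ^ d ∧ (t : ℝ) ^ d ≤ l * Q := by
    intro t h1 h2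
    refine ⟨Real.rpow_le_rpow hT0.le h1 hd0.le, ?_⟩
    calc (t : ℝ) ^ d ≤ (l * T) ^ d := Real.rpow_le_rpow (by positivity) h2 hd0.le
      _ = l ^ d * Q := Real.mul_rpow hl0.le hT0.le
      _ ≤ l * Q := by
        gcongr
        calc l ^ d ≤ l ^ (1 : ℝ) := Real.rpow_le_rpow_of_exponent_le hl1.le hd1.le
          _ = l := Real.rpow_one l
  set w : Finset ℕ := Finset.Icc ⌈T⌉₊ ⌊l * T⌋₊ with hw
  have hwm : ∀ t : ℕ, t ∈ w ↔ T ≤ t ∧ t ≤ l * T := fun t => by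
    rw [hw, Finset.mem_Icc, Nat.ceil_le, Nat.le_floor_iff (by positivity)]
  rcases w.eq_empty_or_nonempty with hwe | hwne
  · have : {ω | ∃ t : ℕ, T ≤ t ∧ t ≤ l * T ∧ ∃ n : ℕ, K * Q ≤ n ∧
        ¬ GoodSum h d ε (fun j => Z j ω) n t} = ∅ := by
      ext ω
      simp only [Set.mem_ofPred_eq, Set.mem_empty_iff_false, iff_false]
      rintro ⟨t, h1, h2, -⟩
      have := (hwm t).2 ⟨h1, h2⟩
      rw [hwe] at this
      simp at this
    rw [this, measure_empty]
    exact zero_le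
  -- The thresholds need not be monotone in time, so the extremes are taken over the finite window
  -- rather than at its endpoints.
  obtain ⟨t₁, ht₁, hmin⟩ := w.exists_min_image c hwne
  obtain ⟨t₂, ht₂, hmax⟩ := w.exists_max_image c hwne
  set e : ℕ → ℝ := fun t => ∫ x, h t x ∂μ with he
  have het : ∀ t ∈ w, 1 ≤ l * ((t : ℝ) ^ d * e t) ∧ (t : ℝ) ^ d * e t ≤ l ∧ 1 ≤ l ^ 2 * (Q * e t)
      ∧ Q * e t ≤ l ∧ 0 < e t ∧ MemLp (h t) 2 μ ∧ Q * ∫ x, h t x ^ 2 ∂μ ≤ |C₀| := by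
    intro t ht
    obtain ⟨h1, h2⟩ := (hwm t).1 ht
    obtain ⟨q1, q2⟩ := hQt t h1 h2
    obtain ⟨⟨m1, m2⟩, m3, m4⟩ := hT₁ t (by exact_mod_cast hTT₁.trans h1)
    have htd : 0 < (t : ℝ) ^ d := hQ0.trans_le q1
    have he0 : 0 < e t := by
      have : 0 < (t : ℝ) ^ d * e t := (inv_pos.2 hl0).trans m1
      exact pos_of_mul_pos_right this htd.le
    have m1' : 1 < l * ((t : ℝ) ^ d * e t) := by
      rwa [inv_lt_iff_one_lt_mul₀' hl0] at m1
    refine ⟨m1'.le, m2.le, ?_, ?_, he0, m3, ?_⟩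
    · calc 1 ≤ l * ((t : ℝ) ^ d * e t) := m1'.le
        _ ≤ l * (l * Q * e t) := by gcongr
        _ = _ := by ring
    · calc Q * e t ≤ (t : ℝ) ^ d * e t := by gcongr
        _ ≤ l := m2.le
    · calc Q * ∫ x, h t x ^ 2 ∂μ ≤ (t : ℝ) ^ d * ∫ x, h t x ^ 2 ∂μ := by
            gcongr
        _ ≤ C₀ := m4
        _ ≤ |C₀| := le_abs_self _
  let N : ℕ → ℕ := fun s => ⌈K * l ^ s * Q⌉₊
  have hN : ∀ s, K * l ^ s * Q ≤ N s := fun s => Nat.le_ceil _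
  have hN0 : ∀ s, (0 : ℝ) < N s := fun s => lt_of_lt_of_le (by positivity) (hN s)
  have hNQ : ∀ s, 1 ≤ l * (l - 1) * N s := fun s => by
    have h1 : Q ≤ N s := by
      refine le_trans ?_ (hN s)
      have : 1 ≤ K * l ^ s := one_le_mul_of_one_le_of_one_le hK (one_le_pow₀ hl1.le)
      exact le_mul_of_one_le_left hQ0.le this
    have h2 := hQl.trans h1
    rwa [div_le_iff₀' (by positivity)] at h2
  have hNs : ∀ s, (N (s + 1) : ℝ) ≤ l ^ 2 * N s := fun s => by
    have h1 : (N (s + 1) : ℝ) < K * l ^ (s + 1) * Q + 1 := Nat.ceil_lt_add_one (by positivity)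
    have h2 : K * l ^ (s + 1) * Q ≤ l * N s := by
      rw [pow_succ]
      have := mul_le_mul_of_nonneg_left (hN s) hl0.le
      linarith
    have := hNQ s
    nlinarith
  let D : ℕ → ℕ → Set Ω := fun t s =>
    {ω | (l - 1) * (N s * e t) ≤ |∑ j ∈ Finset.range (N s), h t (Z j ω) - N s * e t|}
  have hD : ∀ t ∈ w, ∀ s, P (D t s) ≤ ENNReal.ofReal (C₁ / K * l⁻¹ ^ s) := by
    intro t ht s
    obtain ⟨-, -, m3, -, m5, m6, m7⟩ := het t ht
    refine (measure_deviation_le hZm hZl hZi (hh.meas t) m6 (N s)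
      (mul_pos hlm (mul_pos (hN0 s) m5))).trans (ENNReal.ofReal_le_ofReal ?_)
    set V := ∫ x, h t x ^ 2 ∂μ
    rw [div_le_iff₀ (by have := hN0 s; positivity)]
    have hn := hN s
    have h1 : 1 ≤ l ^ 4 * (Q * e t) ^ 2 := by
      have := pow_le_pow_left₀ zero_le_one m3 2
      calc (1 : ℝ) = 1 ^ 2 := by norm_num
        _ ≤ _ := this
        _ = _ := by ring
    have h2 : (1 : ℝ) ≤ N s / (K * l ^ s * Q) := by
      rw [one_le_div (by positivity)]; exact hn
    calc (N s : ℝ) * V = N s * (Q * V) / Q := by field_simp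
      _ ≤ N s * |C₀| / Q := by
        gcongr
      _ = N s * |C₀| / Q * 1 * 1 := by ring
      _ ≤ N s * |C₀| / Q * (l ^ 4 * (Q * e t) ^ 2) * (N s / (K * l ^ s * Q)) := by gcongr
      _ = C₁ / K * l⁻¹ ^ s * ((l - 1) * (N s * e t)) ^ 2 := by
        rw [hC₁]
        have : l - 1 ≠ 0 := hlm.ne'
        rw [inv_pow]
        field_simp
  have hsub : {ω | ∃ t : ℕ, T ≤ t ∧ t ≤ l * T ∧ ∃ n : ℕ, K * Q ≤ n ∧
        ¬ GoodSum h d ε (fun j => Z j ω) n t} ⊆ ⋃ s, (D t₁ s ∪ D t₂ s) := by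
    rintro ω ⟨t, hTt, htT, n, hn, hbad⟩
    by_contra hω
    simp only [Set.mem_iUnion, Set.mem_union, not_exists, not_or, D, Set.mem_ofPred_eq,
      not_le] at hω
    apply hbad
    have htw := (hwm t).2 ⟨hTt, htT⟩
    obtain ⟨q1, q2⟩ := hQt t hTt htT
    have htd : 0 < (t : ℝ) ^ d := hQ0.trans_le q1
    have hKQ : 0 < K * Q := by positivity
    obtain ⟨s, hs1, hs2⟩ := exists_nat_pow_near ((one_le_div hKQ).2 hn) hl1
    rw [le_div_iff₀ hKQ] at hs1
    rw [div_lt_iff₀ hKQ] at hs2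
    have n1 : N s ≤ n := Nat.ceil_le.2 (by linarith)
    have n2 : n ≤ N (s + 1) := by
      have h1 : (n : ℝ) ≤ N (s + 1) := by
        have := hN (s + 1)
        linarith
      exact_mod_cast h1
    have n1' : (N s : ℝ) ≤ n := by exact_mod_cast n1
    have n2' : (n : ℝ) ≤ N (s + 1) := by exact_mod_cast n2
    have n3 := hNs s
    have hn0 : (0 : ℝ) < n := (hN0 s).trans_le n1'
    have mono_n : ∀ (u a b : ℕ), a ≤ b → ∑ j ∈ Finset.range a, h u (Z j ω)
        ≤ ∑ j ∈ Finset.range b, h u (Z j ω) := fun u a b hab =>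
      Finset.sum_le_sum_of_subset_of_nonneg (Finset.range_mono hab)
        fun j _ _ => hh.nonneg u _
    obtain ⟨-, -, -, a4, a5, -, -⟩ := het t₁ ht₁
    obtain ⟨-, -, b3, -, b5, -, -⟩ := het t₂ ht₂
    have up : ∑ j ∈ Finset.range n, h t (Z j ω) ≤ l * (l ^ 2 * n * e t₁) := by
      calc ∑ j ∈ Finset.range n, h t (Z j ω) ≤ ∑ j ∈ Finset.range n, h t₁ (Z j ω) :=
            Finset.sum_le_sum fun j _ => hc _ _ (hmin t htw) _
        _ ≤ ∑ j ∈ Finset.range (N (s + 1)), h t₁ (Z j ω) := mono_n _ _ _ n2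
        _ ≤ l * (N (s + 1) * e t₁) := by
            have := (abs_lt.1 (hω (s + 1)).1).2
            linarith
        _ ≤ l * (l ^ 2 * n * e t₁) := by
            gcongr
            exact n3.trans (by gcongr)
    have lo : (2 - l) * (N s * e t₂) ≤ ∑ j ∈ Finset.range n, h t (Z j ω) := by
      calc (2 - l) * (N s * e t₂) ≤ ∑ j ∈ Finset.range (N s), h t₂ (Z j ω) := by
            have := (abs_lt.1 (hω s).2).1
            linarith
        _ ≤ ∑ j ∈ Finset.range n, h t₂ (Z j ω) := mono_n _ _ _ n1
        _ ≤ ∑ j ∈ Finset.range n, h t (Z j ω) :=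
            Finset.sum_le_sum fun j _ => hc _ _ (hmax t htw) _
    set W := ∑ j ∈ Finset.range n, h t (Z j ω) with hW
    have up2 : (t : ℝ) ^ d * W ≤ (1 + ε) * n := by
      calc (t : ℝ) ^ d * W ≤ (l * Q) * (l * (l ^ 2 * n * e t₁)) := by
            have hW0 : 0 ≤ W := Finset.sum_nonneg fun j _ => hh.nonneg _ _
            gcongr
        _ = l ^ 4 * n * (Q * e t₁) := by ring
        _ ≤ l ^ 4 * n * l := by gcongr
        _ = l ^ 5 * n := by ring
        _ ≤ (1 + ε) * n := by gcongr
    have lo2 : (1 - ε) * n ≤ (t : ℝ) ^ d * W := by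
      have hl2' : 0 ≤ 2 - l := by linarith
      have h1 : (2 - l) * n ≤ l ^ 4 * ((t : ℝ) ^ d * W) := by
        calc (2 - l) * n ≤ (2 - l) * (l ^ 2 * N s) := by
              gcongr
              exact n2'.trans n3
          _ = (2 - l) * (l ^ 2 * N s) * 1 := by ring
          _ ≤ (2 - l) * (l ^ 2 * N s) * (l ^ 2 * (Q * e t₂)) := by gcongr
          _ = l ^ 4 * (Q * ((2 - l) * (N s * e t₂))) := by ring
          _ ≤ l ^ 4 * (Q * W) := by gcongr
          _ ≤ l ^ 4 * ((t : ℝ) ^ d * W) := by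
              have hW0 : 0 ≤ W := Finset.sum_nonneg fun j _ => hh.nonneg _ _
              gcongr
      have h2 : (1 - ε) * n * l ^ 4 ≤ (t : ℝ) ^ d * W * l ^ 4 := by
        calc (1 - ε) * n * l ^ 4 = (1 - ε) * l ^ 4 * n := by ring
          _ ≤ (2 - l) * n := by gcongr
          _ ≤ _ := h1
          _ = _ := by ring
      exact le_of_mul_le_mul_right h2 (by positivity)
    unfold GoodSum
    rw [← hW, abs_le]
    constructor <;> linarith
  have hsum : HasSum (fun s : ℕ => 2 * (C₁ / K) * l⁻¹ ^ s) (2 * (C₁ / K) * (1 - l⁻¹)⁻¹) :=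
    (hasSum_geometric_of_lt_one hr0 hr1).mul_left _
  calc P _ ≤ P (⋃ s, (D t₁ s ∪ D t₂ s)) := measure_mono hsub
    _ ≤ ∑' s, P (D t₁ s ∪ D t₂ s) := measure_iUnion_le _
    _ ≤ ∑' s, ENNReal.ofReal (2 * (C₁ / K) * l⁻¹ ^ s) := by
        refine ENNReal.tsum_le_tsum fun s => ?_
        refine (measure_union_le _ _).trans ((add_le_add (hD t₁ ht₁ s) (hD t₂ ht₂ s)).trans ?_)
        rw [← ENNReal.ofReal_add (by positivity) (by positivity)]
        apply ENNReal.ofReal_le_ofReal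
        linarith
    _ = ENNReal.ofReal (2 * C₁ * (1 - l⁻¹)⁻¹ / K) := by
        rw [← ENNReal.ofReal_tsum_of_nonneg (fun s => by positivity) hsum.summable, hsum.tsum_eq]
        congr 1
        ring

/-- When the number of samples is proportional to time, the sums are eventually all good. -/
theorem IsTailFamily.ae_eventually_good {d : ℝ} (hd0 : 0 < d) (hd1 : d < 1) {h : ℕ → ℝ → ℝ}
    (hh : IsTailFamily μ d h) {ε : ℝ} (hε : 0 < ε) {c : ℝ} (hc : 0 < c) :
    ∀ᵐ ω ∂P, ∀ᶠ t : ℕ in atTop, ∀ n : ℕ, c * t ≤ n → GoodSum h d ε (fun j => Z j ω) n t := by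
  obtain ⟨l, hl, C, hC, T₀, hT₀, H⟩ := hh.window hZm hZl hZi hd0 hd1 hε
  have hl0 : 0 < l := by linarith
  -- On the window starting at `T = l ^ r`, linear sample size `c * T` means `K * T ^ d` with `K = c
  -- * ρ ^ r`. The failure probabilities `C / K` are then geometric.
  set ρ : ℝ := l ^ (1 - d) with hρ
  have hρ1 : 1 < ρ := Real.one_lt_rpow hl (by linarith)
  have hρ0 : 0 < ρ := by linarith
  have hKeq : ∀ r : ℕ, c * ρ ^ r * (l ^ r) ^ d = c * l ^ r := fun r => by
    have : ρ ^ r = (l ^ r) ^ (1 - d) := by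
      rw [hρ, ← Real.rpow_natCast, ← Real.rpow_mul hl0.le, mul_comm, Real.rpow_mul hl0.le,
        Real.rpow_natCast]
    rw [mul_assoc, this, ← Real.rpow_add (by positivity)]
    norm_num
  obtain ⟨r₀, hr₀⟩ := eventually_atTop.1
    (((tendsto_pow_atTop_atTop_of_one_lt hl).eventually_ge_atTop T₀).and
      (((tendsto_pow_atTop_atTop_of_one_lt hρ1).const_mul_atTop hc).eventually_ge_atTop 1))
  let B : ℕ → Set Ω := fun r => {ω | ∃ t : ℕ, l ^ (r + r₀) ≤ t ∧ t ≤ l * l ^ (r + r₀) ∧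
    ∃ n : ℕ, c * ρ ^ (r + r₀) * (l ^ (r + r₀)) ^ d ≤ n ∧ ¬ GoodSum h d ε (fun j => Z j ω) n t}
  have hB : ∀ r, P (B r) ≤ ENNReal.ofReal (C / c * ρ⁻¹ ^ r) := fun r => by
    obtain ⟨h1, h2⟩ := hr₀ (r + r₀) (by omega)
    refine (H _ h1 _ h2).trans (ENNReal.ofReal_le_ofReal ?_)
    rw [inv_pow, ← div_eq_mul_inv, div_div]
    have : ρ ^ r ≤ ρ ^ (r + r₀) := pow_le_pow_right₀ hρ1.le (by omega)
    gcongr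
  have hs : Summable fun r : ℕ => C / c * ρ⁻¹ ^ r :=
    (summable_geometric_of_lt_one (by positivity) (inv_lt_one_of_one_lt₀ hρ1)).mul_left _
  have hfin : ∑' r, P (B r) ≠ ⊤ := by
    refine ne_top_of_le_ne_top ?_ (ENNReal.tsum_le_tsum hB)
    rw [← ENNReal.ofReal_tsum_of_nonneg (fun r => by positivity) hs]
    exact ENNReal.ofReal_ne_top
  filter_upwards [ae_eventually_notMem hfin] with ω hω
  obtain ⟨r₁, hr₁⟩ := eventually_atTop.1 hω
  obtain ⟨T, hT⟩ := exists_nat_ge (l ^ (r₁ + r₀))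
  filter_upwards [eventually_ge_atTop T] with t ht n hn
  have hTt : l ^ (r₁ + r₀) ≤ (t : ℝ) := hT.trans (by exact_mod_cast ht)
  obtain ⟨s, hs1, hs2⟩ := exists_nat_pow_near ((one_le_pow₀ hl.le).trans hTt) hl
  have hsr : r₁ + r₀ ≤ s := by
    have := (pow_lt_pow_iff_right₀ hl).1 (hTt.trans_lt hs2)
    omega
  obtain ⟨r, rfl⟩ : ∃ r, s = r + r₀ := ⟨s - r₀, by omega⟩
  by_contra hbad
  refine hr₁ r (by omega) ⟨t, hs1, by rw [← pow_succ']; exact hs2.le, n, ?_, hbad⟩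
  rw [hKeq]
  exact le_trans (by gcongr) hn

/-- Over a window of bounded ratio, the probability that some sum over sufficiently many samples
is bad is small. -/
theorem IsTailFamily.long_window {d : ℝ} (hd0 : 0 < d) (hd1 : d < 1) {h : ℕ → ℝ → ℝ}
    (hh : IsTailFamily μ d h) {ε : ℝ} (hε : 0 < ε) {M : ℝ} {η : ENNReal} (hη : 0 < η) :
    ∃ K₀ : ℝ, ∀ K ≥ K₀, ∀ᶠ T : ℕ in atTop,
      P {ω | ∃ t : ℕ, T ≤ t ∧ t ≤ M * T ∧ ∃ n : ℕ, K * (t : ℝ) ^ d ≤ n ∧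
        ¬ GoodSum h d ε (fun j => Z j ω) n t} ≤ η := by
  obtain ⟨l, hl, C, hC, T₀, hT₀, H⟩ := hh.window hZm hZl hZi hd0 hd1 hε
  have hl0 : 0 < l := by linarith
  -- A bounded number of windows of ratio `l` covers `[T, M * T]`, so the failure bound remains of
  -- order `1 / K`.
  obtain ⟨R, hR⟩ := pow_unbounded_of_one_lt M hl
  have hlim : Tendsto (fun K : ℝ => ENNReal.ofReal ((R + 1 : ℕ) * (C / K))) atTop (𝓝 0) := by
    rw [← ENNReal.ofReal_zero]
    apply ENNReal.tendsto_ofReal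
    have : Tendsto (fun K : ℝ => C / K) atTop (𝓝 0) := tendsto_const_nhds.div_atTop tendsto_id
    simpa using this.const_mul ((R + 1 : ℕ) : ℝ)
  obtain ⟨K₀, hK₀⟩ := eventually_atTop.1
    ((hlim.eventually (gt_mem_nhds hη)).and (eventually_ge_atTop 1))
  refine ⟨K₀, fun K hK => ?_⟩
  obtain ⟨hK1, hK2⟩ := hK₀ K hK
  obtain ⟨T₁, hT₁⟩ := exists_nat_ge T₀
  filter_upwards [eventually_ge_atTop T₁] with T hT
  have hTT : T₀ ≤ T := hT₁.trans (by exact_mod_cast hT)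
  have hT0 : (0 : ℝ) < T := by linarith
  have hsub : {ω | ∃ t : ℕ, T ≤ t ∧ t ≤ M * T ∧ ∃ n : ℕ, K * (t : ℝ) ^ d ≤ n ∧
        ¬ GoodSum h d ε (fun j => Z j ω) n t} ⊆ ⋃ s ∈ Finset.range (R + 1),
      {ω | ∃ t : ℕ, l ^ s * T ≤ t ∧ t ≤ l * (l ^ s * T) ∧ ∃ n : ℕ, K * (l ^ s * T) ^ d ≤ n ∧
        ¬ GoodSum h d ε (fun j => Z j ω) n t} := by
    rintro ω ⟨t, h1, h2, n, hn, hbad⟩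
    have h1' : (T : ℝ) ≤ t := by exact_mod_cast h1
    obtain ⟨s, hs1, hs2⟩ := exists_nat_pow_near ((one_le_div hT0).2 h1') hl
    rw [le_div_iff₀ hT0] at hs1
    rw [div_lt_iff₀ hT0] at hs2
    have hsR : s < R := by
      rw [← pow_lt_pow_iff_right₀ hl]
      have : l ^ s * T ≤ M * T := hs1.trans h2
      exact (le_of_mul_le_mul_right this hT0).trans_lt hR
    simp only [Set.mem_iUnion]
    refine ⟨s, Finset.mem_range.2 (by omega), t, hs1, ?_, n, ?_, hbad⟩
    · rw [pow_succ] at hs2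
      linarith
    · refine le_trans ?_ hn
      gcongr
  calc P _ ≤ P _ := measure_mono hsub
    _ ≤ ∑ s ∈ Finset.range (R + 1), _ := measure_biUnion_finset_le _ _
    _ ≤ ∑ s ∈ Finset.range (R + 1), ENNReal.ofReal (C / K) := by
        refine Finset.sum_le_sum fun s _ => H _ ?_ K hK2
        exact hTT.trans (le_mul_of_one_le_left hT0.le (one_le_pow₀ hl.le))
    _ = ENNReal.ofReal ((R + 1 : ℕ) * (C / K)) := by
        rw [Finset.sum_const, Finset.card_range, nsmul_eq_mul,
          ENNReal.ofReal_mul (Nat.cast_nonneg _), ENNReal.ofReal_natCast]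
    _ ≤ η := hK1.le

end

/-- If the probabilities of events `B i K T` become small as `K` grows, uniformly in large `T`, then
almost surely, for some `K`, infinitely often none of the events occurs. -/
theorem ae_exists_frequently_notMem {Ω ι : Type*} [MeasurableSpace Ω] {P : Measure Ω} [Fintype ι]
    {B : ι → ℝ → ℕ → Set Ω}
    (hB : ∀ i, ∀ η : ENNReal, 0 < η → ∃ K₀ : ℝ, ∀ K ≥ K₀, ∀ᶠ T in atTop, P (B i K T) ≤ η) :
    ∀ᵐ ω ∂P, ∃ K, ∃ᶠ T in atTop, ∀ i, ω ∉ B i K T := by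
  rw [ae_iff]
  refine le_antisymm (ENNReal.le_of_forall_pos_le_add fun η hη _ => ?_) zero_le
  rw [zero_add]
  have hη' : (0 : ENNReal) < η / (Fintype.card ι + 1 : ℕ) :=
    ENNReal.div_pos (by exact_mod_cast hη.ne') (ENNReal.natCast_ne_top _)
  choose K₀ hK₀ using fun i => hB i _ hη'
  set K := ∑ i, |K₀ i|
  have hK : ∀ i, K₀ i ≤ K := fun i => (le_abs_self _).trans
    (Finset.single_le_sum (f := fun i => |K₀ i|) (fun _ _ => abs_nonneg _) (Finset.mem_univ i))
  obtain ⟨T₀, hT₀⟩ := eventually_atTop.1 (eventually_all.2 fun i => hK₀ i K (hK i))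
  have hU : ∀ T ≥ T₀, P (⋃ i, B i K T) ≤ η := fun T hT => by
    calc P (⋃ i, B i K T) ≤ ∑ i, P (B i K T) := measure_iUnion_fintype_le _ _
      _ ≤ ∑ i : ι, (η : ENNReal) / (Fintype.card ι + 1 : ℕ) := Finset.sum_le_sum fun i _ => hT₀ T hT i
      _ = Fintype.card ι * ((η : ENNReal) / (Fintype.card ι + 1 : ℕ)) := by simp
      _ ≤ (Fintype.card ι + 1 : ℕ) * ((η : ENNReal) / (Fintype.card ι + 1 : ℕ)) := by
          gcongr
          omega
      _ ≤ η := ENNReal.mul_div_le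
  -- Failure at all times from `T` on is contained in failure at a single late time, hence has
  -- probability at most `η`. These events increase with `T`, so their union obeys the same bound.
  let A : ℕ → Set Ω := fun T => ⋂ S ≥ T, ⋃ i, B i K S
  have hA : Monotone A := fun S T hST =>
    Set.biInter_subset_biInter_left fun u (hu : T ≤ u) => hST.trans hu
  have hsub : {ω | ¬ ∃ K, ∃ᶠ T in atTop, ∀ i, ω ∉ B i K T} ⊆ ⋃ T, A T := by
    intro ω hω
    simp only [Set.mem_ofPred_eq, not_exists, not_frequently] at hω
    obtain ⟨T, hT⟩ := eventually_atTop.1 (hω K)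
    simp only [Set.mem_iUnion, A, Set.mem_iInter]
    refine ⟨T, fun S hS => ?_⟩
    simpa using hT S hS
  refine (measure_mono hsub).trans ?_
  rw [hA.measure_iUnion]
  refine iSup_le fun T => ?_
  refine le_trans (measure_mono ?_) (hU (max T T₀) (le_max_right _ _))
  exact Set.biInter_subset_of_mem (le_max_left T T₀)

/-! ### The ratio estimator -/

/-- The two statistics of the ratio estimator: the exceedance indicator (`true`), and the
logarithmic excess in units of the tail index (`false`). -/
def tailStat (γ : ℕ → ℝ) (β : ℝ) : Bool → ℕ → ℝ → ℝ
  | true => fun t x => if γ t < x then 1 else 0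
  | false => fun t x => logExcess (γ t) x / β

theorem IsHeavyTailed.tendsto_threshold {μ : Measure ℝ} [IsProbabilityMeasure μ] {β d : ℝ}
    (hμ : IsHeavyTailed μ β) (hd : 0 < d) {γ : ℕ → ℝ}
    (hγ : Tendsto (fun t : ℕ => (t : ℝ) ^ d * μ.real (Set.Ioi (γ t))) atTop (𝓝 1)) :
    Tendsto γ atTop atTop := by
  have h1 : Tendsto (fun t : ℕ => (t : ℝ) ^ d) atTop atTop :=
    (tendsto_rpow_atTop hd).comp tendsto_natCast_atTop_atTop
  have h2 : Tendsto (fun t => μ.real (Set.Ioi (γ t))) atTop (𝓝 0) := by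
    refine (hγ.div_atTop h1).congr' ?_
    filter_upwards [h1.eventually_gt_atTop 0] with t ht
    field_simp
  refine tendsto_atTop.2 fun c => ?_
  filter_upwards [h2.eventually (gt_mem_nhds (hμ.tail_pos c))] with t ht
  by_contra hlt
  exact absurd (measureReal_mono (Set.Ioi_subset_Ioi (not_le.1 hlt).le)) (not_le.2 ht)

theorem IsHeavyTailed.isTailFamily {μ : Measure ℝ} [IsProbabilityMeasure μ] {β d : ℝ}
    (hμ : IsHeavyTailed μ β) (hd : 0 < d) {γ : ℕ → ℝ} (hγ0 : ∀ t, 0 < γ t)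
    (hγ : Tendsto (fun t : ℕ => (t : ℝ) ^ d * μ.real (Set.Ioi (γ t))) atTop (𝓝 1)) (s : Bool) :
    IsTailFamily μ d (tailStat γ β s) := by
  have hβ := hμ.index_pos
  have hγt := hμ.tendsto_threshold hd hγ
  have hbd := hγ.eventually (gt_mem_nhds (one_lt_two))
  cases s
  · refine ⟨fun t x => div_nonneg (logExcess_nonneg (hγ0 t) x) hβ.le,
      fun t => (measurable_logExcess _).div_const _,
      ⟨γ, fun s t hst x => ?_⟩, ?_, ?_⟩
    · exact div_le_div_of_nonneg_right (logExcess_anti (hγ0 s) hst x) hβ.le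
    · have h1 := hγ.mul ((hμ.tendsto_mean_logExcess.comp hγt).div_const β)
      rw [div_self hβ.ne', one_mul] at h1
      refine h1.congr fun t => ?_
      have := (hμ.tail_pos (γ t)).ne'
      simp only [tailStat, integral_div, Function.comp_apply]
      field_simp
    · obtain ⟨C, hC⟩ := hμ.exists_sq_le
      refine ⟨2 * |C| / β ^ 2, ?_⟩
      filter_upwards [hγt.eventually hC, hbd] with t ht ht2
      refine ⟨?_, ?_⟩
      · simp only [tailStat, div_eq_mul_inv]
        exact ht.1.mul_const _
      · simp only [tailStat, div_pow, integral_div]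
        rw [← mul_div_assoc]
        refine div_le_div_of_nonneg_right ?_ (by positivity)
        calc (t : ℝ) ^ d * ∫ x, logExcess (γ t) x ^ 2 ∂μ
            ≤ (t : ℝ) ^ d * (|C| * μ.real (Set.Ioi (γ t))) := by
              gcongr
              exact ht.2.trans (by gcongr; exact le_abs_self C)
          _ = ((t : ℝ) ^ d * μ.real (Set.Ioi (γ t))) * |C| := by ring
          _ ≤ 2 * |C| := by gcongr
  · have he : ∀ t, tailStat γ β true t = (Set.Ioi (γ t)).indicator 1 := fun t => by
      funext x
      simp [tailStat, Set.indicator_apply]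
    have hi : ∀ t, ∫ x, tailStat γ β true t x ∂μ = μ.real (Set.Ioi (γ t)) := fun t => by
      rw [he, integral_indicator_one measurableSet_Ioi]
    refine ⟨fun t x => ?_, fun t => ?_, ⟨γ, fun s t hst x => ?_⟩, ?_, ⟨2, ?_⟩⟩
    · simp only [tailStat]; split_ifs <;> norm_num
    · exact Measurable.ite measurableSet_Ioi measurable_const measurable_const
    · simp only [tailStat]
      by_cases h : γ t < x
      · rw [if_pos h, if_pos (hst.trans_lt h)]
      · rw [if_neg h]; split_ifs <;> norm_num
    · simpa only [hi] using hγ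
    · filter_upwards [hbd] with t ht
      have hsq : ∀ x, tailStat γ β true t x ^ 2 = tailStat γ β true t x := fun x => by
        simp only [tailStat]; split_ifs <;> norm_num
      refine ⟨?_, ?_⟩
      · rw [he]
        exact (memLp_const (1 : ℝ)).indicator measurableSet_Ioi
      · simp only [hsq, hi]
        exact ht.le

/-- The ratio estimator is defined and close to the tail index. -/
def GoodEstimate (γ : ℕ → ℝ) (β η : ℝ) (z : ℕ → ℝ) (n t : ℕ) : Prop :=
  0 < numExceed z (γ t) n ∧ |ratioEstimator z (γ t) n - β| < η

theorem exists_goodEstimate {β : ℝ} (hβ : 0 < β) (γ : ℕ → ℝ) (d : ℝ) {η : ℝ} (hη : 0 < η) :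
    ∃ ε > 0, ∀ (z : ℕ → ℝ) (n t : ℕ), 0 < n → 0 < t →
      (∀ s, GoodSum (tailStat γ β s) d ε z n t) → GoodEstimate γ β η z n t := by
  -- The estimator is `β` times a ratio of two sums, each within `ε * n` of `n` after normalization.
  -- The denominator is at least `n / 2`, so the error is at most `4 * β * ε ≤ η / 2`.
  refine ⟨min (1 / 2) (η / (8 * β)), by positivity, fun z n t hn ht hg => ?_⟩
  set ε := min (1 / 2) (η / (8 * β)) with hεd
  have hε : 0 < ε := by positivity
  have hε1 : ε ≤ 1 / 2 := min_le_left _ _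
  have hε2 : 8 * β * ε ≤ η := by
    have : ε ≤ η / (8 * β) := min_le_right _ _
    rwa [le_div_iff₀' (by positivity)] at this
  have hn0 : (0 : ℝ) < n := by exact_mod_cast hn
  have htd : 0 < (t : ℝ) ^ d := Real.rpow_pos_of_pos (by exact_mod_cast ht) d
  set W := (t : ℝ) ^ d
  have hN : ∑ j ∈ Finset.range n, tailStat γ β true t (z j) = numExceed z (γ t) n := by
    simp [tailStat, numExceed]
  have hS : ∑ j ∈ Finset.range n, tailStat γ β false t (z j)
      = (∑ j ∈ (Finset.range n).filter (fun j => γ t < z j),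
        (Real.log (z j) - Real.log (γ t))) / β := by
    rw [Finset.sum_filter, Finset.sum_div]
    rfl
  have h1 := hg true
  have h2 := hg false
  unfold GoodSum at h1 h2
  rw [hN, abs_le] at h1
  rw [hS, abs_le] at h2
  set S := ∑ j ∈ (Finset.range n).filter (fun j => γ t < z j), (Real.log (z j) - Real.log (γ t))
    with hSd
  set E : ℝ := (numExceed z (γ t) n : ℝ) with hE
  have hεn : ε * n ≤ 1 / 2 * n := by gcongr
  have hWE : 1 / 2 * n ≤ W * E := by linarith [h1.1]
  have hE0 : 0 < E := by
    have : 0 < W * E := by linarith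
    exact pos_of_mul_pos_right this htd.le
  refine ⟨Nat.cast_pos.1 hE0, ?_⟩
  have e : ratioEstimator z (γ t) n - β = β * (W * (S / β) - W * E) / (W * E) := by
    unfold ratioEstimator
    rw [← hSd, ← hE]
    field_simp
  have h3 : |W * (S / β) - W * E| ≤ 2 * (ε * n) := by
    rw [abs_le]; constructor <;> linarith [h1.1, h1.2, h2.1, h2.2]
  have hWE0 : 0 < W * E := by positivity
  rw [e, abs_div, abs_mul, abs_of_pos hβ, abs_of_pos hWE0, div_lt_iff₀ hWE0]
  calc β * |W * (S / β) - W * E| ≤ β * (2 * (ε * n)) := by gcongr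
    _ = 8 * β * ε * (n / 4) := by ring
    _ ≤ η * (n / 4) := by gcongr
    _ < η * (1 / 2 * n) := by
      have : (n : ℝ) / 4 < 1 / 2 * n := by linarith
      gcongr
    _ ≤ η * (W * E) := by gcongr

/-! ### Convergence along a sample path -/

/-- Deterministic core of the argument. The hypothesis `hwin` starts the self-sustaining regime in
one good window, and `hgood` maintains it afterwards. The window ratio `(1 + m) / c` is long enough
for tracking to forget the counts at its start. -/
theorem IsTIROPath.tendsto {k : ℕ} (hk : 2 ≤ k) {β : Fin k → ℝ} (hβ : ∀ i, 0 < β i)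
    {b : Fin k} (hb : ∀ i, i ≠ b → β b < β i) {a : Fin k → ℝ}
    (ha : IsSimplexArgmax (rateFn β b) a) {c : ℝ} (hc : 0 < c) (hca : ∀ i, c ≤ a i)
    {n₀ m : ℕ} (hm : 1 ≤ m) {γ x : Fin k → ℕ → ℝ} {π : ℕ → Fin k}
    (h : IsTIROPath n₀ m γ x π) {d η K : ℝ}
    (hη : ∀ β' : Fin k → ℝ, (∀ i, |β' i - β i| < η) → ∀ b', (∀ i, β' b' ≤ β' i) →
      ∀ a', IsSimplexArgmax (rateFn β' b') a' → ∀ i, |a' i - a i| < c / (4 * k))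
    (hη0 : 0 < η)
    (hgood : ∀ η > 0, ∀ᶠ t : ℕ in atTop, ∀ i, ∀ n : ℕ, c / 2 * t ≤ n →
      GoodEstimate (γ i) (β i) η (x i) n t)
    (hwin : ∃ᶠ T : ℕ in atTop, ∀ i, ∀ t : ℕ, T ≤ t → t ≤ (1 + m) / c * T → ∀ n : ℕ, 0 < n →
      K * (t : ℝ) ^ d ≤ n → GoodEstimate (γ i) (β i) η (x i) n t)
    (hN : ∀ i, ∀ᶠ t : ℕ in atTop, 0 < numSamples π i t ∧ K * (t : ℝ) ^ d ≤ numSamples π i t) :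
    Tendsto (fun t => samplingRatio π t) atTop (𝓝 a) := by
  obtain ⟨A, hA, htr⟩ := h.exists_tracks hm
  set τ := k * n₀ with hτ
  have hk0 : (0 : ℝ) < k := by exact_mod_cast (by omega : 0 < k)
  have hm0 : (0 : ℝ) < m := by exact_mod_cast hm
  have near : ∀ {η' e : ℝ}, (∀ β' : Fin k → ℝ, (∀ i, |β' i - β i| < η') → ∀ b',
      (∀ i, β' b' ≤ β' i) → ∀ a', IsSimplexArgmax (rateFn β' b') a' → ∀ i, |a' i - a i| < e) →
      ∀ n, (∀ i, GoodEstimate (γ i) (β i) η' (x i) (numSamples π i (τ + n * m)) (τ + n * m)) →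
      ∀ i, A n i ≤ a i + e := by
    intro η' e he n hg i
    obtain ⟨b', hb', hmax⟩ := (hA n).2 fun i => (hg i).1
    have := he _ (fun i => (hg i).2) b' hb' _ hmax i
    linarith [(abs_lt.1 this).2]
  obtain ⟨T₀, hT₀⟩ := eventually_atTop.1 ((hgood η hη0).and (eventually_all.2 hN))
  obtain ⟨T₁, hT₁⟩ := exists_nat_ge (4 * k / c)
  obtain ⟨T, hTge, hT⟩ := frequently_atTop.1 hwin (T₀ + T₁ + τ + 1)
  -- A decision time in `[T, T + m]`, hence at most `(1 + m) * T`. Past the window, `c` times the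
  -- current time dominates it, as the tracking bounds require.
  set n₁ := (T - τ) / m + 1 with hn₁
  have d1 : T ≤ τ + n₁ * m := by
    have := Nat.lt_div_mul_add (a := T - τ) (b := m) hm
    rw [hn₁, add_mul, one_mul]
    omega
  have d2 : τ + n₁ * m ≤ T + m := by
    have := Nat.div_mul_le_self (T - τ) m
    rw [hn₁, add_mul, one_mul]
    omega
  have hT1 : (1 : ℝ) ≤ T := by exact_mod_cast (by omega : 1 ≤ T)
  have d2' : ((τ + n₁ * m : ℕ) : ℝ) ≤ (1 + m) * T := by
    have : ((τ + n₁ * m : ℕ) : ℝ) ≤ T + m := by exact_mod_cast d2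
    nlinarith
  have hmono : ∀ n, n₁ ≤ n → T ≤ τ + n * m := fun n hn =>
    d1.trans (by gcongr)
  -- Tolerance `c / (4 * k)` costs at most `c / 4` of a share `a i ≥ c`, and the rounding loss `k`
  -- costs another `c / 4` once the time exceeds `4 * k / c`. At least `c / 2` remains.
  have many : ∀ n, n₁ ≤ n → (1 + m) / c * T < ((τ + n * m : ℕ) : ℝ) →
      (∀ l, n₁ ≤ l → l < n → ∀ i, A l i ≤ a i + c / (4 * k)) →
      ∀ i, c / 2 * ((τ + n * m : ℕ) : ℝ) ≤ numSamples π i (τ + n * m) := by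
    intro n hn hlong hl i
    have h1 : ((τ + n₁ * m : ℕ) : ℝ) ≤ c * ((τ + n * m : ℕ) : ℝ) := by
      rw [div_mul_eq_mul_div, div_lt_iff₀' hc] at hlong
      linarith
    have h2 := htr.le_numSamples ha.1.2 hc hca (by positivity) hn hl h1 i
    have h3 : (k : ℝ) * (c / (4 * k)) = c / 4 := by field_simp
    rw [h3] at h2
    have h4 : 4 * k / c ≤ ((τ + n * m : ℕ) : ℝ) := hT₁.trans (by
      have := hmono n hn
      exact_mod_cast (by omega : T₁ ≤ τ + n * m))
    rw [div_le_iff₀' hc] at h4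
    have h5 : ((τ + n * m : ℕ) : ℝ) * (c - c / 4) ≤ ((τ + n * m : ℕ) : ℝ) * (a i - c / 4) := by
      gcongr
      exact hca i
    linarith
  -- Bootstrap: inside the window accuracy is given by `hwin`; beyond it, closeness of all earlier
  -- targets makes the counts linear, and accuracy comes from `hgood`.
  have close : ∀ n, n₁ ≤ n → ∀ i, A n i ≤ a i + c / (4 * k) := by
    intro n
    induction n using Nat.strong_induction_on with
    | _ n ih =>
      intro hn
      have hTn := hmono n hn
      obtain ⟨g1, g2⟩ := hT₀ (τ + n * m) (by omega)
      refine near hη n fun i => ?_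
      rcases le_or_gt ((τ + n * m : ℕ) : ℝ) ((1 + m) / c * T) with hw | hw
      · exact hT i _ hTn hw _ (g2 i).1 (g2 i).2
      · exact g1 i _ (many n hn hw (fun l h1 h2 => ih l h2 h1) i)
  have htend : Tendsto (fun n : ℕ => τ + n * m) atTop atTop :=
    tendsto_atTop_mono (fun n => (Nat.le_mul_of_pos_right n hm).trans (Nat.le_add_left _ _))
      tendsto_id
  refine htr.tendsto hm ha.1 hc hca fun e he => ?_
  obtain ⟨η', hη'0, hη'⟩ := exists_plugIn_near hk hβ hb ha he
  filter_upwards [htend.eventually (hgood η' hη'0), eventually_ge_atTop n₁,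
    (tendsto_natCast_atTop_atTop.comp htend).eventually_gt_atTop ((1 + m) / c * T)] with n hn1 hn2 hn3
  exact near hη' n fun i => hn1 i _ (many n hn2 hn3 (fun l h1 _ => close l h1) i)

end TIRO

end

/-! ### Assembly of the main theorem -/

theorem theorem4
    {Ω : Type*} [MeasurableSpace Ω] (P : Measure Ω) [IsProbabilityMeasure P]
    -- at least two alternatives, with loss laws `law i` and tail indices `β i`
    (k : ℕ) (hk : 2 ≤ k)
    (law : Fin k → Measure ℝ) (β : Fin k → ℝ)
    (hlaw : ∀ i, TIRO.IsHeavyTailed (law i) (β i))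
    -- `b` is the unique alternative with the smallest tail index
    (b : Fin k) (hb : ∀ i, i ≠ b → β b < β i)
    -- `X i j` is the `(j + 1)`-st sample from alternative `i`; all samples are independent
    (X : Fin k → ℕ → Ω → ℝ) (hXmeas : ∀ i j, Measurable (X i j))
    (hXlaw : ∀ i j, P.map (X i j) = law i)
    (hXindep : iIndepFun (fun ij : Fin k × ℕ => X ij.1 ij.2) P)
    -- the thresholds
    (δ : ℝ) (hδ : δ ∈ Set.Ioo (1 / 2 : ℝ) 1)
    (γ : Fin k → ℕ → ℝ) (hγpos : ∀ i t, 0 < γ i t)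
    (hγ : ∀ i, Tendsto (fun t : ℕ => (t : ℝ) ^ (1 - δ) * (law i).real (Set.Ioi (γ i t)))
      atTop (𝓝 1))
    -- the TIRO policy
    (n₀ m : ℕ) (hn₀ : 1 ≤ n₀) (hm : 1 ≤ m)
    (π : ℕ → Ω → Fin k)
    (hπ : ∀ᵐ ω ∂P, TIRO.IsTIROPath n₀ m γ (fun i j => X i j ω) (fun t => π t ω)) :
    ∃ αstar : Fin k → ℝ,
      (∀ a : Fin k → ℝ, TIRO.IsSimplexArgmax (TIRO.rateFn β b) a ↔ a = αstar) ∧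
      ∀ᵐ ω ∂P,
        (∀ i, Tendsto
          (fun t : ℕ => (TIRO.numSamples (fun s => π s ω) i t : ℝ)
            * (law i).real (Set.Ioi (γ i t))) atTop atTop) →
        Tendsto (fun t : ℕ => TIRO.samplingRatio (fun s => π s ω) t) atTop (𝓝 αstar) := by
  have hβ : ∀ i, 0 < β i := fun i => (hlaw i).index_pos
  obtain ⟨a, ha⟩ := TIRO.exists_isSimplexArgmax hk hβ b
  refine ⟨a, fun a' => ⟨fun h => h.unique hk hβ hb ha, fun h => h ▸ ha⟩, ?_⟩
  have hd0 : 0 < 1 - δ := by linarith [hδ.2]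
  have hd1 : 1 - δ < 1 := by linarith [hδ.1]
  set d := 1 - δ
  have : ∀ i, IsProbabilityMeasure (law i) := fun i => by
    rw [← hXlaw i 0]
    exact Measure.isProbabilityMeasure_map (hXmeas i 0).aemeasurable
  have hind : ∀ i, Pairwise fun j l => IndepFun (X i j) (X i l) P := fun i j l hjl =>
    hXindep.indepFun (i := (i, j)) (j := (i, l)) (by simpa using hjl)
  have hfam : ∀ i s, TIRO.IsTailFamily (law i) d (TIRO.tailStat (γ i) (β i) s) := fun i s =>
    (hlaw i).isTailFamily hd0 (hγpos i) (hγ i) s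
  have hk0 : (0 : ℝ) < k := by exact_mod_cast (by omega : 0 < k)
  obtain ⟨-, hapos⟩ := ha.pos hk hβ hb
  have : Nonempty (Fin k) := ⟨b⟩
  obtain ⟨i₀, hi₀⟩ := Finite.exists_min a
  set c := a i₀ with hcdef
  have hc : 0 < c := hapos i₀
  obtain ⟨η, hη0, hη⟩ := TIRO.exists_plugIn_near hk hβ hb ha
    (by positivity : 0 < c / (4 * k))
  choose ε hε0 hε using fun i => TIRO.exists_goodEstimate (hβ i) (γ i) d hη0
  -- Indexing by alternative and statistic yields one `K` and common good windows for all estimators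
  -- at once.
  have hwin := TIRO.ae_exists_frequently_notMem (P := P) (ι := Fin k × Bool)
    (B := fun p K T => {ω | ∃ t : ℕ, T ≤ t ∧ t ≤ (1 + m) / c * (T : ℝ) ∧ ∃ n : ℕ,
      K * (t : ℝ) ^ d ≤ n ∧
        ¬ TIRO.GoodSum (TIRO.tailStat (γ p.1) (β p.1) p.2) d (ε p.1) (fun j => X p.1 j ω) n t})
    (fun p _ hη' => (hfam p.1 p.2).long_window (hXmeas p.1) (hXlaw p.1) (hind p.1) hd0 hd1
      (hε0 p.1) hη')
  -- The precisions `1 / (r + 1)` reduce all `η > 0` to countably many null sets.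
  have hgood : ∀ᵐ ω ∂P, ∀ r : ℕ, ∀ i, ∀ᶠ t : ℕ in atTop, ∀ n : ℕ, c / 2 * t ≤ n →
      TIRO.GoodEstimate (γ i) (β i) (1 / ((r : ℝ) + 1)) (fun j => X i j ω) n t := by
    refine ae_all_iff.2 fun r => ae_all_iff.2 fun i => ?_
    obtain ⟨ε', hε'0, hε'⟩ := TIRO.exists_goodEstimate (hβ i) (γ i) d
      (by positivity : 0 < 1 / ((r : ℝ) + 1))
    have h1 := fun s => (hfam i s).ae_eventually_good (hXmeas i) (hXlaw i) (hind i) hd0 hd1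
      hε'0 (half_pos hc)
    filter_upwards [h1 true, h1 false] with ω h2 h3
    filter_upwards [h2, h3, eventually_gt_atTop 0] with t h4 h5 ht n hn
    have hn0 : 0 < n := by
      have : (0 : ℝ) < n := lt_of_lt_of_le (by positivity) hn
      exact_mod_cast this
    refine hε' _ _ _ hn0 ht fun s => ?_
    cases s
    · exact h5 n hn
    · exact h4 n hn
  filter_upwards [hπ, hwin, hgood] with ω hpath ⟨K, hK⟩ hg hN
  refine hpath.tendsto hk hβ hb ha hc hi₀ hm hη hη0 (d := d) (K := K) ?_ ?_ ?_
  · intro η' hη'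
    obtain ⟨r, hr⟩ := exists_nat_one_div_lt hη'
    filter_upwards [eventually_all.2 (hg r)] with t ht i n hn
    exact ⟨(ht i n hn).1, (ht i n hn).2.trans hr⟩
  · refine (hK.and_eventually (eventually_gt_atTop 0)).mono ?_
    rintro T ⟨hT, hT0⟩ i t h1 h2 n hn0 hn
    refine hε i _ _ _ hn0 (by omega) fun s => ?_
    by_contra hbad
    exact hT (i, s) ⟨t, h1, h2, n, hn, hbad⟩
  · intro i
    -- Condition (1) in the form needed: eventually `t ^ d * p < 2` and `N * p ≥ 2 * K`, so `N ≥ K *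
    -- t ^ d` for the path-dependent `K`.
    have h1 := (hγ i).eventually (gt_mem_nhds one_lt_two)
    filter_upwards [h1, (hN i).eventually_gt_atTop 0,
      (hN i).eventually_ge_atTop (2 * K)] with t h2 h3 h4
    set p := (law i).real (Set.Ioi (γ i t))
    have hp : 0 < p := (hlaw i).tail_pos _
    refine ⟨by exact_mod_cast pos_of_mul_pos_left h3 hp.le, ?_⟩
    rcases le_or_gt K 0 with hK0 | hK0
    · exact (mul_nonpos_of_nonpos_of_nonneg hK0 (by positivity)).trans (Nat.cast_nonneg _)
    · refine le_of_mul_le_mul_right (le_trans ?_ h4) hp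
      rw [mul_assoc, mul_comm 2 K]
      gcongr
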